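/- Let $\alpha=\varepsilon_1-\varepsilon_2$, $Q=\mathbb{Z}\alpha$, $(\varepsilon_j,\varepsilon_k)=\delta_{jk}$, $\lambda_0=0$, $\lambda_1=\alpha/2$. Let $U(\widehat{\mathfrak s}^-)=\mathbb{C}[a_j(-r) : j=1,2,\ r>0]$ and, for $i=0,1$, let $\mathcal{F}_i$ be the $h$-adic completion of $U(\widehat{\mathfrak s}^-)[[h]]\otimes\mathbb{C}[Q][[h]]e^{\lambda_i}$. On $\mathcal{F}_i$, $a_j(-r)$ acts by multiplication, $a_j(r)$ (for $r>0$) acts by the derivation with $a_k(-s)\mapsto r\,\delta_{jk}\delta_{rs}$, $\partial_{\beta}(f\otimes e^\mu)=(\beta,\mu)f\otimes e^\mu$, and $e^{\alpha}(f\otimes e^\mu)=f\otimes e^{\alpha+\mu}$. Consider the operator series \begin{gather*} E^-(u)=\exp\sum_{r>0}\Big(-\tfrac{a_1(-r)}{r}\big(u-\tfrac34 h\big)^r+\tfrac{a_2(-r)}{r}\big(u+\tfrac h4\big)^r\Big),\qquad E^+(u)=\exp\sum_{r>0}\tfrac{a_1(r)-a_2(r)}{r}\big(u+\tfrac h4\big)^{-r},\\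 E^0(u)=e^\alpha\big(u+\tfrac h4\big)^{\partial_\alpha},\qquad X_\alpha(u)=E^-(0)^{-1}E^-(u)E^+(u)E^0(u)\,\frac{u^{\partial_{\alpha/2}}(u+h)^{\partial_{\alpha/2}}}{(u+h/4)^{\partial_\alpha}},\\ \overline{E}^+(u)=\exp\sum_{r>0}\Big(\tfrac{a_1(r)}{r}\big(u-\tfrac74 h\big)^{-r}+\tfrac{a_2(r)}{r}\big(u+\tfrac h4\big)^{-r}\Big),\qquad \overline{E}^0(u)=(1-h/u)^{\partial_{\alpha/2}}, \end{gather*} where all powers are expanded in nonnegative powers of $h$ (and $u^{\partial_{\alpha/2}}(u+h)^{\partial_{\alpha/2}}=u^{\partial_\alpha}(1+h/u)^{\partial_{\alpha/2}}$). Put $\overline{X}(u)=X_\alpha(u)\overline{E}^+(u)\overline{E}^0(u)$. Then the following identities hold for operators on $\mathcal{F}_i$, $i=0,1$: $$\overline{X}(u)\overline{X}(v)=\overline{X}(v)\overline{X}(u),\qquad \overline{X}(u)\overline{X}(u-h)=\overline{X}(u)\overline{X}(u+h)=0.$$ Here the first identity means that all coefficients of $\overline{X}(u)$ commute. In the second,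 $\overline{X}(u)\overline{X}(u\pm h)$ is the formal limit $v\to u\pm h$ of $\overline{X}(u)\overline{X}(v)$, with powers of $u\pm h$ expanded in nonnegative powers of $h$. This limit is well defined: for every $w\in\mathcal{F}_i$ and $n\ge1$, the series $\overline{X}(u)\overline{X}(v)w$ has only finitely many negative powers of $u$ and of $v$ modulo $h^n$, and the resulting coefficient sums converge $h$-adically. -/

import Mathlib

open PowerSeries

noncomputable section

namespace DYangian

/-! ### The space `F_i` and the Heisenberg action -/

/-- The universal enveloping algebra of the commutative Lie algebra with basis `a_j(-r)`, where
`j = 1, 2` and `r > 0`, i.e. its symmetric algebra. The variable `(j, r)` is `a_j(-r)`; the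
indices `j = 1, 2` are written `0, 1 : Fin 2`. -/
abbrev CreationAlg : Type := MvPolynomial (Fin 2 × ℕ+) ℂ

/-- `U(ŝ⁻) ⊗ ℂ[Q] e^{λ_i}`, with `Q = ℤ α`; the group-like element of index `κ : ℤ`
is `e^{κ α + λ_i}`. -/
abbrev V : Type := AddMonoidAlgebra CreationAlg ℤ

/-- The `h`-adically completed, topologically free `ℂ[[h]]`-module `F_i = V[[h]]`;
the power series variable is `h`. -/
abbrev Fock : Type := PowerSeries V

/-- The algebra of `ℂ[[h]]`-linear operators on `F_i`. -/
abbrev FockEnd : Type := Module.End (PowerSeries ℂ) Fock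

/-- The root `α = ε₁ - ε₂`, in coordinates with respect to the orthonormal basis `ε₁, ε₂`. -/
def alpha : Fin 2 → ℂ := ![1, -1]

/-- The classical part `λ_i = Λ_i - Λ_0` of the fundamental weight: `λ_0 = 0`, `λ_1 = α / 2`. -/
def lam (i : Fin 2) : Fin 2 → ℂ := if i = 0 then 0 else (1 / 2 : ℂ) • alpha

/-- The weight `κ α + λ_i`. -/
def weight (i : Fin 2) (κ : ℤ) : Fin 2 → ℂ := (κ : ℂ) • alpha + lam i

/-- The standard bilinear form, `(ε_j, ε_k) = δ_{jk}`. -/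
def form (x y : Fin 2 → ℂ) : ℂ := x ⬝ᵥ y

/-- The operator `f ⊗ e^μ ↦ φ(f) ⊗ e^μ`. -/
def onCreation (φ : CreationAlg →ₗ[ℂ] CreationAlg) : Module.End ℂ V where
  toFun v := AddMonoidAlgebra.ofCoeff (v.coeff.mapRange φ (map_zero φ))
  map_add' v w := by ext1; simp [Finsupp.mapRange_add]
  map_smul' c v := by ext1; ext1 κ; simp

/-- The operator `a_j(r)`: multiplication by `a_j(r)` if `r < 0`, and the derivation
`f ↦ [a_j(r), f]` with `[a_j(r), a_k(-s)] = r δ_{jk} δ_{rs}` if `r > 0`.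
(There is no `a_j(0)`; its value here is `0`.) -/
def a (j : Fin 2) (r : ℤ) : Module.End ℂ V :=
  if r < 0 then onCreation (LinearMap.mulLeft ℂ (MvPolynomial.X (j, r.natAbs.toPNat')))
  else onCreation ((r : ℂ) • (MvPolynomial.pderiv (R := ℂ) (j, r.natAbs.toPNat')).toLinearMap)

/-- The operator `e^α : f ⊗ e^μ ↦ f ⊗ e^{α + μ}`. -/
def eAlpha : Module.End ℂ V where
  toFun v := AddMonoidAlgebra.ofCoeff (v.coeff.mapDomain (fun κ => κ + 1))
  map_add' v w := by ext1; simp [Finsupp.mapDomain_add]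
  map_smul' c v := by ext1; simp [Finsupp.mapDomain_smul]

/-- The operator `f ⊗ e^μ ↦ φ(μ) f ⊗ e^μ` on `F_i`. -/
def diag (i : Fin 2) (φ : (Fin 2 → ℂ) → ℂ) : Module.End ℂ V where
  toFun v := AddMonoidAlgebra.ofCoeff
    (Finsupp.onFinset v.coeff.support (fun κ => φ (weight i κ) • v.coeff κ)
      (fun κ hκ => by
        rw [Finsupp.mem_support_iff]
        intro h0
        exact hκ (by rw [h0, smul_zero])))
  map_add' v w := by ext1; ext1 κ; simp
  map_smul' c v := by ext1; ext1 κ; simp [smul_comm c]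

theorem coeff_series_smul (c : PowerSeries ℂ) (w : Fock) (n : ℕ) :
    coeff n (c • w) =
      ∑ p ∈ Finset.HasAntidiagonal.antidiagonal n, coeff p.1 c • coeff p.2 w := by
  have h : c • w = PowerSeries.map (algebraMap ℂ V) c * w := rfl
  rw [h, coeff_mul]
  refine Finset.sum_congr rfl fun p _ => ?_
  rw [coeff_map, ← Algebra.smul_def]

/-- An element of `End_ℂ(V)[[h]]` acts `ℂ[[h]]`-linearly on `F_i = V[[h]]`. -/
def toEnd (T : PowerSeries (Module.End ℂ V)) : FockEnd where
  toFun w := PowerSeries.mk fun n =>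
    ∑ p ∈ Finset.HasAntidiagonal.antidiagonal n, (coeff p.1 T) (coeff p.2 w)
  map_add' v w := by ext1 n; simp [Finset.sum_add_distrib]
  map_smul' c w := by
    ext1 n
    simp only [coeff_series_smul, RingHom.id_apply, coeff_mk, map_sum, map_smul, Finset.smul_sum,
      Finset.sum_sigma']
    refine Finset.sum_bij' (fun x _ => ⟨(x.2.1, x.1.1 + x.2.2), (x.1.1, x.2.2)⟩)
      (fun x _ => ⟨(x.2.1, x.1.1 + x.2.2), (x.1.1, x.2.2)⟩) ?_ ?_ ?_ ?_ ?_
    all_goals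
      rintro ⟨⟨a, b⟩, ⟨c, d⟩⟩ hx
      simp only [Finset.mem_sigma, Finset.HasAntidiagonal.mem_antidiagonal] at hx ⊢
    · exact ⟨by omega, trivial⟩
    · exact ⟨by omega, trivial⟩
    · obtain ⟨_, rfl⟩ := hx; rfl
    · obtain ⟨_, rfl⟩ := hx; rfl

/-! ### Formal series in `h` and one more variable -/

/-- `∑ₖ (binomial s c k) hᵏ xˢ⁻ᵏ` is the expansion of `(x + c h)ˢ` in nonnegative powers of `h`. -/
def binomial (s c : ℂ) (k : ℕ) : ℂ := Ring.choose s k * c ^ k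

/-- The formal exponential `∑ₙ fⁿ / n!` of a series in two variables over a `ℂ`-algebra, for `f`
with zero constant term. The outer variable is `u` or `u⁻¹`, the inner one is `h`. As `fⁿ` has no
terms of total degree less than `n`, only `n ≤ m + k` contribute to the term of degree
`(m, k)`. -/
def formalExp {A : Type} [Ring A] [Algebra ℂ A] (f : PowerSeries (PowerSeries A)) :
    PowerSeries (PowerSeries A) :=
  PowerSeries.mk fun m => PowerSeries.mk fun k =>
    ∑ n ∈ Finset.range (m + k + 1), ((n.factorial : ℂ)⁻¹) • coeff k (coeff m (f ^ n))

/-- `∑_{r > 0} (a_j(-r) / r) (u + c h)ʳ`, the outer variable being `u`. The terms of degree `m`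
in `u` and `k` in `h` come from `r = m + k`. -/
def negSum (j : Fin 2) (c : ℂ) : PowerSeries (PowerSeries (Module.End ℂ V)) :=
  PowerSeries.mk fun m => PowerSeries.mk fun k =>
    if 0 < m + k then
      (((m + k : ℕ) : ℂ)⁻¹ * binomial ((m + k : ℕ) : ℂ) c k) • a j (-((m + k : ℕ) : ℤ))
    else 0

/-- `∑_{r > 0} (a_j(r) / r) (u + c h)⁻ʳ`, the outer variable being `u⁻¹`. The terms of degree `m`
in `u⁻¹` and `k` in `h` come from `r = m - k`. -/
def posSum (j : Fin 2) (c : ℂ) : PowerSeries (PowerSeries (Module.End ℂ V)) :=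
  PowerSeries.mk fun m => PowerSeries.mk fun k =>
    if k < m then
      (((m - k : ℕ) : ℂ)⁻¹ * binomial (-((m - k : ℕ) : ℂ)) c k) • a j ((m - k : ℕ) : ℤ)
    else 0

/-- `E⁻(u)` as a series in `u` and `h`. -/
def EMinusSeries : PowerSeries (PowerSeries (Module.End ℂ V)) :=
  formalExp (-negSum 0 (-3 / 4) + negSum 1 (1 / 4))

/-- `E⁺(u)` as a series in `u⁻¹` and `h`. -/
def EPlusSeries : PowerSeries (PowerSeries (Module.End ℂ V)) :=
  formalExp (posSum 0 (1 / 4) - posSum 1 (1 / 4))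

/-- `Ē⁺(u)` as a series in `u⁻¹` and `h`. -/
def EBarPlusSeries : PowerSeries (PowerSeries (Module.End ℂ V)) :=
  formalExp (posSum 0 (-7 / 4) + posSum 1 (1 / 4))

/-! ### Operator series on `F_i` -/

/-- Formal operator series `B(u) = ∑_{n ∈ ℤ} B n uⁿ` on `F_i`. -/
abbrev OpSeries : Type := ℤ → FockEnd

/-- A family of elements of `F_i = V[[h]]` is summable in the `h`-adic topology, with sum `s`:
modulo every power of `h` all but finitely many members vanish, and the rest adds up to `s`. -/
def HasHSum {ι : Type} (f : ι → Fock) (s : Fock) : Prop :=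
  ∀ k, {x | coeff k (f x) ≠ 0}.Finite ∧ ∑ᶠ x, coeff k (f x) = coeff k s

/-- For every `w ∈ F_i` and every `K`, only finitely many powers of `u`
occur in `C(u) w` modulo `h^K`. -/
def LocFinite (C : OpSeries) : Prop :=
  ∀ w k, {n : ℤ | coeff k (C n w) ≠ 0}.Finite

theorem coeff_end_eq_zero (T : FockEnd) {y : Fock} {k : ℕ} (hy : ∀ l ≤ k, coeff l y = 0) :
    coeff k (T y) = 0 := by
  obtain ⟨z, hz⟩ : (PowerSeries.X : Fock) ^ (k + 1) ∣ y :=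
    PowerSeries.X_pow_dvd_iff.2 fun l hl => hy l (by omega)
  have h : y = (PowerSeries.X : PowerSeries ℂ) ^ (k + 1) • z := by
    have h1 : (PowerSeries.X : PowerSeries ℂ) ^ (k + 1) • z =
      PowerSeries.map (algebraMap ℂ V) (PowerSeries.X ^ (k + 1)) * z := rfl
    rw [h1, map_pow, PowerSeries.map_X, hz]
  have h2 : T y = PowerSeries.map (algebraMap ℂ V) (PowerSeries.X ^ (k + 1)) * T z := by
    rw [h, map_smul]; rfl
  rw [h2, map_pow, PowerSeries.map_X]
  exact PowerSeries.X_pow_dvd_iff.1 (dvd_mul_right _ _) k (by omega)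

theorem mul_finite (B : OpSeries) {C : OpSeries} (hC : LocFinite C) (N : ℤ) (w : Fock) (k : ℕ) :
    {n : ℤ | coeff k (B (N - n) (C n w)) ≠ 0}.Finite := by
  refine ((Finset.range (k + 1)).finite_toSet.biUnion (fun l _ => hC w l)).subset ?_
  intro n hn
  by_contra hcon
  simp only [Set.mem_iUnion, Set.mem_ofPred_eq, not_exists, not_not, Finset.coe_range,
    Set.mem_Iio] at hcon
  exact hn (coeff_end_eq_zero _ fun l hl => hcon l (by omega))

/-- The product `B(u) C(u)` of operator series in the same variable: its coefficient at `u^N` is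
the operator `w ↦ ∑ₙ B_{N-n} (C_n w)`, where the sum converges `h`-adically. -/
def mul (B C : OpSeries) (hC : LocFinite C) : OpSeries := fun N =>
  { toFun := fun w => PowerSeries.mk fun k => ∑ᶠ n, coeff k (B (N - n) (C n w))
    map_add' := fun v w => by
      ext1 k
      simp only [map_add, coeff_mk]
      exact finsum_add_distrib (mul_finite B hC N v k) (mul_finite B hC N w k)
    map_smul' := fun c w => by
      ext1 k
      simp only [map_smul, coeff_series_smul, coeff_mk, RingHom.id_apply]
      rw [finsum_sum_comm]
      · refine Finset.sum_congr rfl fun p _ => ?_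
        rw [smul_finsum' _ (mul_finite B hC N w p.2)]
      · intro p _
        exact (mul_finite B hC N w p.2).subset fun n hn h0 => hn (by simp [h0]) }

theorem mul_hasHSum (B : OpSeries) {C : OpSeries} (hC : LocFinite C) (N : ℤ) (w : Fock) :
    HasHSum (fun n => B (N - n) (C n w)) (mul B C hC N w) := fun k =>
  ⟨mul_finite B hC N w k, by simp [mul]⟩

/-- A series in `u` and `h` as an operator series. -/
def ofU (f : PowerSeries (PowerSeries (Module.End ℂ V))) : OpSeries := fun n =>
  if 0 ≤ n then toEnd (coeff n.toNat f) else 0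

/-- A series in `u⁻¹` and `h` as an operator series. -/
def ofUInv (f : PowerSeries (PowerSeries (Module.End ℂ V))) : OpSeries := fun n =>
  if n ≤ 0 then toEnd (coeff (-n).toNat f) else 0

/-- The operator series `f ⊗ e^μ ↦ u^{p(μ)} (1 + c h / u)^{q(μ)} f ⊗ e^μ`, where `p(μ) ∈ ℤ`;
the term `u^{p(μ) - k} hᵏ` has coefficient `binomial (q μ) c k`. -/
def zeroMode (i : Fin 2) (p q : (Fin 2 → ℂ) → ℂ) (c : ℂ) : OpSeries := fun n =>
  toEnd (PowerSeries.mk fun k => diag i fun μ =>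
    open Classical in if p μ = (n : ℂ) + (k : ℂ) then binomial (q μ) c k else 0)

/-! #### Local finiteness -/

theorem locFinite_of {C : OpSeries} (T : ℤ → PowerSeries (Module.End ℂ V))
    (hC : ∀ n, C n = toEnd (T n))
    (hT : ∀ v k, {n : ℤ | coeff k (T n) v ≠ 0}.Finite) : LocFinite C := by
  intro w K
  refine ((Finset.HasAntidiagonal.antidiagonal K).finite_toSet.biUnion
    (fun p _ => hT (coeff p.2 w) p.1)).subset ?_
  intro n hn
  by_contra hcon
  simp only [Set.mem_iUnion, Set.mem_ofPred_eq, not_exists, not_not] at hcon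
  refine hn ?_
  rw [hC]
  simp only [toEnd, LinearMap.coe_mk, AddHom.coe_mk, coeff_mk]
  exact Finset.sum_eq_zero fun p hp => hcon p hp

theorem zeroMode_locFinite (i : Fin 2) (p q : (Fin 2 → ℂ) → ℂ) (c : ℂ) :
    LocFinite (zeroMode i p q c) := by
  refine locFinite_of _ (fun n => rfl) fun v k => ?_
  refine (v.coeff.support.finite_toSet.biUnion
    (t := fun κ => {n : ℤ | p (weight i κ) = (n : ℂ) + (k : ℂ)}) fun κ _ => ?_).subset ?_
  · refine Set.Subsingleton.finite fun n hn n' hn' => ?_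
    simp only [Set.mem_ofPred_eq] at hn hn'
    have h := hn.symm.trans hn'
    exact_mod_cast add_right_cancel h
  · intro n hn
    by_contra hcon
    simp only [Set.mem_iUnion, Set.mem_ofPred_eq, not_exists] at hcon
    refine hn (AddMonoidAlgebra.ext (Finsupp.ext fun κ => ?_))
    by_cases hκ : κ ∈ v.coeff.support
    · simp [diag, hcon κ hκ]
    · simp [diag, Finsupp.notMem_support_iff.1 hκ]

theorem comp_locFinite (T : FockEnd) {C : OpSeries} (hC : LocFinite C) :
    LocFinite (fun n => T * C n) := by
  intro w k
  refine ((Finset.range (k + 1)).finite_toSet.biUnion (fun l _ => hC w l)).subset ?_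
  intro n hn
  by_contra hcon
  simp only [Set.mem_iUnion, Set.mem_ofPred_eq, not_exists, not_not, Finset.coe_range,
    Set.mem_Iio] at hcon
  exact hn (coeff_end_eq_zero T (y := C n w) fun l hl => hcon l (by omega))

/-- The elements of `V` of weight `e`, where `a_j(-r)` has weight `r`. -/
def HasWeight (e : ℤ) (v : V) : Prop :=
  ∀ κ, MvPolynomial.IsWeightedHomogeneous (fun x : Fin 2 × ℕ+ => ((x.2 : ℕ) : ℤ)) (v.coeff κ) e

/-- The coefficient of `u⁻ᵐ hᵏ` lowers the weight by `m - k`. -/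
def Lowers (f : PowerSeries (PowerSeries (Module.End ℂ V))) : Prop :=
  ∀ (m k : ℕ) (e : ℤ) (v : V), HasWeight e v → HasWeight (e - m + k) (coeff k (coeff m f) v)

theorem HasWeight.zero (e : ℤ) : HasWeight e 0 := fun κ => by
  simpa using MvPolynomial.isWeightedHomogeneous_zero _ _ _

theorem HasWeight.add {e : ℤ} {v w : V} (hv : HasWeight e v) (hw : HasWeight e w) :
    HasWeight e (v + w) := fun κ => by simpa using (hv κ).add (hw κ)

theorem HasWeight.smul {e : ℤ} {v : V} (c : ℂ) (hv : HasWeight e v) :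
    HasWeight e (c • v) := fun κ => by
  have := (MvPolynomial.weightedHomogeneousSubmodule ℂ
    (fun x : Fin 2 × ℕ+ => ((x.2 : ℕ) : ℤ)) e).smul_mem c (hv κ)
  simpa using this

theorem HasWeight.sum {ι : Type} {e : ℤ} (s : Finset ι) {v : ι → V}
    (hv : ∀ x ∈ s, HasWeight e (v x)) : HasWeight e (∑ x ∈ s, v x) := by
  classical
  induction s using Finset.induction_on with
  | empty => simpa using HasWeight.zero e
  | insert x s hx ih =>
    rw [Finset.sum_insert hx]
    exact (hv x (Finset.mem_insert_self _ _)).add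
      (ih fun y hy => hv y (Finset.mem_insert_of_mem hy))

theorem Lowers.add {f g : PowerSeries (PowerSeries (Module.End ℂ V))} (hf : Lowers f)
    (hg : Lowers g) : Lowers (f + g) := fun m k e v hv => by
  simpa using (hf m k e v hv).add (hg m k e v hv)

theorem Lowers.neg {f : PowerSeries (PowerSeries (Module.End ℂ V))} (hf : Lowers f) :
    Lowers (-f) := fun m k e v hv => by
  simpa using (hf m k e v hv).smul (-1)

theorem Lowers.one : Lowers 1 := fun m k e v hv => by
  rw [coeff_one]
  split_ifs with h
  · rw [coeff_one]
    split_ifs with h'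
    · subst h h'; simpa using hv
    · simpa using HasWeight.zero _
  · simpa using HasWeight.zero _

theorem Lowers.mul {f g : PowerSeries (PowerSeries (Module.End ℂ V))} (hf : Lowers f)
    (hg : Lowers g) : Lowers (f * g) := fun m k e v hv => by
  rw [coeff_mul, map_sum, LinearMap.sum_apply]
  refine HasWeight.sum _ fun p hp => ?_
  rw [coeff_mul, LinearMap.sum_apply]
  refine HasWeight.sum _ fun q hq => ?_
  have h := hf p.1 q.1 _ _ (hg p.2 q.2 e v hv)
  simp only [Finset.HasAntidiagonal.mem_antidiagonal] at hp hq
  have h2 : e - (p.2 : ℤ) + q.2 - p.1 + q.1 = e - m + k := by omega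
  rw [h2] at h
  exact h

theorem Lowers.pow {f : PowerSeries (PowerSeries (Module.End ℂ V))} (hf : Lowers f) (n : ℕ) :
    Lowers (f ^ n) := by
  induction n with
  | zero => simpa using Lowers.one
  | succ n ih => rw [pow_succ]; exact ih.mul hf

theorem Lowers.formalExp {f : PowerSeries (PowerSeries (Module.End ℂ V))} (hf : Lowers f) :
    Lowers (formalExp f) := fun m k e v hv => by
  simp only [DYangian.formalExp, coeff_mk, LinearMap.sum_apply, LinearMap.smul_apply]
  exact HasWeight.sum _ fun n _ => ((hf.pow n) m k e v hv).smul _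

theorem lowers_posSum (j : Fin 2) (c : ℂ) : Lowers (posSum j c) := fun m k e v hv => by
  simp only [posSum, coeff_mk]
  split_ifs with hkm
  · rw [LinearMap.smul_apply]
    refine HasWeight.smul _ ?_
    have h1 : ¬ (((m - k : ℕ) : ℤ) < 0) := by omega
    intro κ
    simp only [a, if_neg h1, onCreation, LinearMap.coe_mk, AddHom.coe_mk,
      Finsupp.mapRange_apply, LinearMap.smul_apply]
    refine (MvPolynomial.weightedHomogeneousSubmodule ℂ
      (fun x : Fin 2 × ℕ+ => ((x.2 : ℕ) : ℤ)) _).smul_mem _ ?_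
    refine (hv κ).pderiv ?_
    have h2 : ((Int.natAbs ((m - k : ℕ) : ℤ)).toPNat' : ℕ) = m - k := by
      rw [Int.natAbs_natCast, Nat.toPNat'_coe, if_pos (by omega)]
    simp only [h2]
    omega
  · simpa using HasWeight.zero _

theorem Lowers.finite {f : PowerSeries (PowerSeries (Module.End ℂ V))} (hf : Lowers f)
    (v : V) (k : ℕ) : {m : ℕ | coeff k (coeff m f) v ≠ 0}.Finite := by
  have key : ∀ (v : V) (e : ℤ), HasWeight e v →
      {m : ℕ | coeff k (coeff m f) v ≠ 0}.Finite := by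
    intro v e hv
    refine (Set.finite_Iic (e + k).toNat).subset fun m hm => ?_
    by_contra hlt
    rw [Set.mem_Iic, not_le] at hlt
    refine hm (AddMonoidAlgebra.ext (Finsupp.ext fun κ => ?_))
    have h := hf m k e v hv κ
    by_contra hne
    obtain ⟨d, hd⟩ := MvPolynomial.ne_zero_iff.1 hne
    have h3 := h hd
    have h4 : 0 ≤ Finsupp.weight (fun x : Fin 2 × ℕ+ => ((x.2 : ℕ) : ℤ)) d := by
      rw [Finsupp.weight_apply]
      exact Finset.sum_nonneg fun x _ => by positivity
    omega
  have hadd : ∀ v w : V, {m : ℕ | coeff k (coeff m f) v ≠ 0}.Finite →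
      {m : ℕ | coeff k (coeff m f) w ≠ 0}.Finite →
      {m : ℕ | coeff k (coeff m f) (v + w) ≠ 0}.Finite := by
    intro v w hv hw
    refine (hv.union hw).subset fun m hm => ?_
    by_contra hcon
    simp only [Set.mem_union, Set.mem_ofPred_eq, not_or, not_not] at hcon
    exact hm (by rw [map_add, hcon.1, hcon.2, add_zero])
  induction v using AddMonoidAlgebra.induction_linear with
  | zero => simp
  | add v w hv hw => exact hadd v w hv hw
  | single κ p =>
    induction p using MvPolynomial.induction_on' with
    | monomial d c =>
      refine key _ (Finsupp.weight (fun x : Fin 2 × ℕ+ => ((x.2 : ℕ) : ℤ)) d) fun κ' => ?_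
      rw [AddMonoidAlgebra.coeff_single, Finsupp.single_apply]
      split_ifs
      · exact MvPolynomial.isWeightedHomogeneous_monomial _ _ _ rfl
      · exact MvPolynomial.isWeightedHomogeneous_zero _ _ _
    | add p q hp hq =>
      rw [AddMonoidAlgebra.single_add]
      exact hadd _ _ hp hq

theorem Lowers.locFinite {f : PowerSeries (PowerSeries (Module.End ℂ V))} (hf : Lowers f) :
    LocFinite (ofUInv f) := by
  refine locFinite_of (fun n => if n ≤ 0 then coeff (-n).toNat f else 0) (fun n => ?_)
    fun v k => ?_
  · simp only [ofUInv]
    split_ifs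
    · rfl
    · ext1 w; ext1 K; simp [toEnd]
  · refine ((hf.finite v k).image (fun m : ℕ => -(m : ℤ))).subset fun n hn => ?_
    simp only [Set.mem_ofPred_eq] at hn
    split_ifs at hn with h0
    · exact ⟨(-n).toNat, hn, by simp; omega⟩
    · simp at hn

/-! ### The vertex operators -/

/-- `E⁻(u)`. -/
def EMinus : OpSeries := ofU EMinusSeries

theorem isUnit_EMinusSeries_zero : IsUnit (coeff 0 EMinusSeries) := by
  have h : constantCoeff (coeff 0 EMinusSeries) = ((1 : (Module.End ℂ V)ˣ) : Module.End ℂ V) := by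
    simp [EMinusSeries, formalExp]
  exact ⟨⟨_, invOfUnit _ 1, mul_invOfUnit _ _ h, invOfUnit_mul _ _ h⟩, rfl⟩

/-- `E⁻(0)⁻¹`, the inverse being taken in `End_ℂ(V)[[h]]`, where `E⁻(0)` is a unit. -/
def EMinusZeroInv : FockEnd := toEnd (Ring.inverse (coeff 0 EMinusSeries))

/-- `E⁺(u)`. -/
def EPlus : OpSeries := ofUInv EPlusSeries

/-- `E⁰(u) = e^α (u + h/4)^{∂_α}`. -/
def EZero (i : Fin 2) : OpSeries := fun n =>
  toEnd (PowerSeries.C eAlpha) * zeroMode i (form alpha) (form alpha) (1 / 4) n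

/-- `u^{∂_{α/2}} (u + h)^{∂_{α/2}} = u^{∂_α} (1 + h/u)^{∂_{α/2}}`. -/
def halfPowers (i : Fin 2) : OpSeries :=
  zeroMode i (form alpha) (form ((1 / 2 : ℂ) • alpha)) 1

/-- `(u + h/4)^{-∂_α}`. -/
def invPower (i : Fin 2) : OpSeries := zeroMode i (form (-alpha)) (form (-alpha)) (1 / 4)

/-- `Ē⁺(u)`. -/
def EBarPlus : OpSeries := ofUInv EBarPlusSeries

/-- `Ē⁰(u) = (1 - h/u)^{∂_{α/2}}`. -/
def EBarZero (i : Fin 2) : OpSeries := zeroMode i 0 (form ((1 / 2 : ℂ) • alpha)) (-1)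

theorem EPlus_locFinite : LocFinite EPlus := by
  refine Lowers.locFinite (Lowers.formalExp ?_)
  rw [sub_eq_add_neg]
  exact (lowers_posSum _ _).add (lowers_posSum _ _).neg

theorem EBarPlus_locFinite : LocFinite EBarPlus :=
  Lowers.locFinite (Lowers.formalExp ((lowers_posSum _ _).add (lowers_posSum _ _)))

theorem EZero_locFinite (i : Fin 2) : LocFinite (EZero i) :=
  comp_locFinite _ (zeroMode_locFinite i _ _ _)

/-- `X_α(u) = E⁻(0)⁻¹ E⁻(u) E⁺(u) E⁰(u) · u^{∂_{α/2}} (u + h)^{∂_{α/2}} (u + h/4)^{-∂_α}`. -/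
def XAlpha (i : Fin 2) : OpSeries :=
  mul
    (mul
      (mul
        (mul (fun n => EMinusZeroInv * EMinus n) EPlus EPlus_locFinite)
        (EZero i) (EZero_locFinite i))
      (halfPowers i) (zeroMode_locFinite i _ _ _))
    (invPower i) (zeroMode_locFinite i _ _ _)

/-- `X̄(u) = X_α(u) Ē⁺(u) Ē⁰(u)`. -/
def XBar (i : Fin 2) : OpSeries :=
  mul (mul (XAlpha i) EBarPlus EBarPlus_locFinite) (EBarZero i) (zeroMode_locFinite i _ _ _)

/-! ### The formal limit `v → u + c h` -/

/-- The series `∑ y m n uᵐ vⁿ` has, modulo every power of `h`, only finitely many negative powers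
of `u` and of `v`. -/
def LowerBounded (y : ℤ → ℤ → Fock) : Prop :=
  ∀ k, ∃ B : ℤ, ∀ m n, m < B ∨ n < B → coeff k (y m n) = 0

/-- `z(u) = ∑ z N u^N` is the value at `v = u + c h` of `y(u, v) = ∑ y m n uᵐ vⁿ`, with
`(u + c h)ⁿ` expanded in nonnegative powers of `h`: the family of all contributions to the
coefficient of `u^N` is `h`-adically summable with sum `z N`. -/
def HasShiftedValue (c : ℂ) (y : ℤ → ℤ → Fock) (z : ℤ → Fock) : Prop :=
  ∀ N : ℤ, HasHSum
    (fun x : ℤ × ℕ => (binomial (x.1 : ℂ) c x.2 • (PowerSeries.X : PowerSeries ℂ) ^ x.2) •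
      y (N - x.1 + x.2) x.1) (z N)

end DYangian

end

/-!
The operator series `X̄(u)` is brought into the normally ordered form `M(u) R(u)`. Here
`M(u) = E⁻(0)⁻¹ E⁻(u)` consists of creation operators, and `R(u) = Φ(u) e^α G(u)`, where
`Φ(u) = E⁺(u) Ē⁺(u)` consists of annihilation operators and `G(u)` collects the zero modes: on
`f ⊗ e^μ` it is multiplication by `u^{(α, μ)} (1 - h² / u²)^{(α, μ) / 2}`, since the powers of
`u + h/4` cancel (`XBar_eq_mul`).

The interaction of the factors is rational. The creation part solves `M' = N M`, `M(0) = 1`, where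
`N(v)` is linear in the `a_j(-r)`, and `Φ(u) N(v) = (N(v) + c(u, v)) Φ(u)` for the scalar series
`c(u, v) = - 1 / (u - v - h) - 1 / (u - v + h)`, the logarithmic derivative in `v` of
`Q(u, v) = (u - v)² - h²`. Hence `Q(u, 0) Φ(u) M(v)` and `Q(u, v) M(v) Φ(u)` solve the same linear
differential equation in `v` with the same initial value, so they are equal
(`intertwine_of_recursion`, `annihilation_exchange`). This route needs no closed form of
`E⁺(u) E⁻(v)`, hence no logarithms.

The remaining denominator `Q(u, 0) = u² - h²` is absorbed by the zero modes. As `(α, α) = 2`, the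
series `S(u) = R(u) / (u² - h²)` arises from `R(u)` by a shift of the weight by `-α` in `G(u)`
(`shiftOp_eq_sub`), and `R(u) M(v) = Q(u, v) M(v) S(u)` (`rightOp_mul_creationOp`). Therefore
`X̄(u) X̄(v) = ((u - v)² - h²) Z(u, v)` with `Z(u, v) = M(u) M(v) S(u) R(v)`
(`XBar_mul_XBar_apply`).

Moving `e^α` past the zero modes of `S(u)` undoes the shift, so that `S(u) R(v) = S(v) R(u)`, and
`Z` is symmetric (`normalProduct_symm`); so is `X̄(u) X̄(v)`, and the coefficients of `X̄` commute.
Applied to a vector, `Z` has only finitely many negative powers of `u` and of `v` modulo every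
power of `h`, because `M` has none and `R`, `S` are locally finite. So `Z` can be evaluated at
`v = u ± h`, where the factor `(u - v)² - h²` vanishes (`LowerBounded.hasShiftedValue_zero`).
-/

noncomputable section

namespace DYangian

/-! ### Summable families and products of operator series -/

theorem HasHSum.unique {ι : Type} {f : ι → Fock} {s t : Fock} (hs : HasHSum f s)
    (ht : HasHSum f t) : s = t := by
  ext1 k
  rw [← (hs k).2, ← (ht k).2]

theorem HasHSum.congr {ι : Type} {f g : ι → Fock} {s : Fock} (h : ∀ x, g x = f x)
    (hf : HasHSum f s) : HasHSum g s := by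
  rwa [funext h]

theorem HasHSum.finite_le {ι : Type} {f : ι → Fock} (hf : ∀ k, {x | coeff k (f x) ≠ 0}.Finite)
    (k : ℕ) : {x | ∃ l ≤ k, coeff l (f x) ≠ 0}.Finite := by
  refine ((Finset.range (k + 1)).finite_toSet.biUnion (fun l _ => hf l)).subset ?_
  rintro x ⟨l, hl, hx⟩
  simp only [Set.mem_iUnion]
  exact ⟨l, by simpa using Nat.lt_succ_of_le hl, hx⟩

theorem hasHSum_sum {ι : Type} {f : ι → Fock} (s : Finset ι) (hf : ∀ x ∉ s, f x = 0) :
    HasHSum f (∑ x ∈ s, f x) := fun k => by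
  have h : {x | coeff k (f x) ≠ 0} ⊆ s := fun x hx => by
    by_contra hxs
    exact hx (by simp [hf x hxs])
  refine ⟨s.finite_toSet.subset h, ?_⟩
  rw [map_sum]
  exact finsum_eq_sum_of_support_subset _ h

theorem HasHSum.zero {ι : Type} : HasHSum (fun _ : ι => 0) 0 := by
  simpa using hasHSum_sum (f := fun _ : ι => 0) ∅ (by simp)

theorem HasHSum.add {ι : Type} {f g : ι → Fock} {s t : Fock} (hf : HasHSum f s)
    (hg : HasHSum g t) : HasHSum (fun x => f x + g x) (s + t) := fun k => by
  refine ⟨((hf k).1.union (hg k).1).subset fun x hx => ?_, ?_⟩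
  · by_contra hcon
    simp only [Set.mem_union, Set.mem_ofPred_eq, not_or, not_not] at hcon
    exact hx (by rw [map_add, hcon.1, hcon.2, add_zero])
  · simp only [map_add]
    rw [finsum_add_distrib (hf k).1 (hg k).1, (hf k).2, (hg k).2]

/-- Operators are `ℂ[[h]]`-linear, hence `h`-adically continuous. -/
theorem HasHSum.map {ι : Type} {f : ι → Fock} {s : Fock} (hf : HasHSum f s) (T : FockEnd) :
    HasHSum (fun x => T (f x)) (T s) := fun k => by
  have hfin := HasHSum.finite_le (fun k => (hf k).1) k
  have hsub : {x | coeff k (T (f x)) ≠ 0} ⊆ hfin.toFinset := fun x hx => by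
    by_contra hcon
    simp only [Set.Finite.coe_toFinset, Set.mem_ofPred_eq, not_exists, not_and, not_not] at hcon
    exact hx (coeff_end_eq_zero T hcon)
  refine ⟨hfin.toFinset.finite_toSet.subset hsub, ?_⟩
  rw [finsum_eq_sum_of_support_subset _ hsub, ← map_sum, ← map_sum, ← sub_eq_zero, ← map_sub,
    ← map_sub]
  refine coeff_end_eq_zero T fun l hl => ?_
  rw [map_sub, ← (hf l).2, map_sum, sub_eq_zero]
  refine (finsum_eq_sum_of_support_subset _ fun x hx => ?_).symm
  simpa using ⟨l, hl, hx⟩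

theorem HasHSum.neg {ι : Type} {f : ι → Fock} {s : Fock} (hf : HasHSum f s) :
    HasHSum (fun x => -f x) (-s) := by
  simpa using hf.map (-1)

theorem HasHSum.sub {ι : Type} {f g : ι → Fock} {s t : Fock} (hf : HasHSum f s)
    (hg : HasHSum g t) : HasHSum (fun x => f x - g x) (s - t) := by
  simpa only [sub_eq_add_neg] using hf.add hg.neg

theorem HasHSum.smul {ι : Type} {f : ι → Fock} {s : Fock} (hf : HasHSum f s)
    (c : PowerSeries ℂ) : HasHSum (fun x => c • f x) (c • s) := by
  simpa using hf.map (c • 1)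

theorem HasHSum.equiv {ι κ : Type} {f : ι → Fock} {s : Fock} (hf : HasHSum f s) (e : κ ≃ ι) :
    HasHSum (fun x => f (e x)) s := fun k => by
  refine ⟨(hf k).1.preimage e.injective.injOn, ?_⟩
  rw [← (hf k).2]
  exact finsum_comp_equiv e (f := fun x => coeff k (f x))

/-- Iterated sums are double sums as soon as the double family is summable. -/
theorem HasHSum.prod {ι κ : Type} {f : ι × κ → Fock} {g : ι → Fock} {s : Fock}
    (hfin : ∀ k, {p | coeff k (f p) ≠ 0}.Finite) (hf : ∀ x, HasHSum (fun y => f (x, y)) (g x))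
    (hg : HasHSum g s) : HasHSum f s := fun k => by
  refine ⟨hfin k, ?_⟩
  rw [finsum_curry _ (hfin k), ← (hg k).2]
  exact finsum_congr fun x => (hf x k).2

/-- Families obtained from a locally finite operator series and an `h`-adically null family are
`h`-adically null. -/
theorem LocFinite.pair_finite {D : OpSeries} (hD : LocFinite D) {y : ℤ → Fock}
    (hy : ∀ k, {n | coeff k (y n) ≠ 0}.Finite) (T : ℤ → ℤ → FockEnd) (k : ℕ) :
    {p : ℤ × ℤ | coeff k (T p.1 p.2 (D p.1 (y p.2))) ≠ 0}.Finite := by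
  have hfin := HasHSum.finite_le hy k
  refine (hfin.biUnion (t := fun n => (fun m => (m, n)) ''
    {m | ∃ l ≤ k, coeff l (D m (y n)) ≠ 0}) fun n _ =>
      (HasHSum.finite_le (hD (y n)) k).image _).subset ?_
  rintro ⟨m, n⟩ hmn
  have h1 : ∃ l ≤ k, coeff l (D m (y n)) ≠ 0 := by
    by_contra! hcon
    exact hmn (coeff_end_eq_zero _ hcon)
  have h2 : ∃ l ≤ k, coeff l (y n) ≠ 0 := by
    obtain ⟨l, hl, h⟩ := h1
    by_contra! hcon
    exact h (coeff_end_eq_zero _ fun q hq => hcon q (hq.trans hl))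
  simp only [Set.mem_iUnion]
  exact ⟨n, h2, m, h1, rfl⟩

theorem LocFinite.mul {C D : OpSeries} (hC : LocFinite C) (hD : LocFinite D) :
    LocFinite (mul C D hD) := fun w k => by
  have h := hC.pair_finite (hD w) (fun _ _ => 1) k
  refine (h.image fun p => p.1 + p.2).subset fun N hN => ?_
  by_contra hcon
  refine hN ?_
  rw [← (mul_hasHSum C hD N w k).2]
  refine finsum_eq_zero_of_forall_eq_zero fun n => ?_
  by_contra hn
  exact hcon ⟨(N - n, n), hn, by simp⟩

/-- The product of two products of operator series as a double sum. -/
theorem mul_apply_mul_hasHSum (B B' : OpSeries) {C C' : OpSeries} (hC : LocFinite C)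
    (hC' : LocFinite C') (a b : ℤ) (w : Fock) :
    HasHSum (fun p : ℤ × ℤ => B (a - p.1) (C p.1 (B' (b - p.2) (C' p.2 w))))
      (mul B C hC a (mul B' C' hC' b w)) := by
  have h : HasHSum (fun p : ℤ × ℤ => B (a - p.2) (C p.2 (B' (b - p.1) (C' p.1 w))))
      (mul B C hC a (mul B' C' hC' b w)) := by
    refine HasHSum.prod (fun k => ?_) (fun n => mul_hasHSum B hC a (B' (b - n) (C' n w)))
      ((mul_hasHSum B' hC' b w).map _)
    exact ((hC.pair_finite (fun k => mul_finite B' hC' b w k) (fun m _ => B (a - m)) k).preimage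
      (Prod.swap_injective.injOn))
  exact h.equiv (Equiv.prodComm ℤ ℤ)

theorem mul_assoc' (B : OpSeries) {C D : OpSeries} (hC : LocFinite C) (hD : LocFinite D) :
    mul (mul B C hC) D hD = mul B (mul C D hD) (hC.mul hD) := by
  funext N
  refine LinearMap.ext fun w => ?_
  have h1 : HasHSum (fun p : ℤ × ℤ => B (N - p.1 - p.2) (C p.2 (D p.1 w)))
      (mul (mul B C hC) D hD N w) := by
    refine HasHSum.prod (fun k => ?_) (fun n => mul_hasHSum B hC (N - n) (D n w))
      (mul_hasHSum (mul B C hC) hD N w)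
    exact ((hC.pair_finite (hD w) (fun m n => B (N - n - m)) k).preimage
      (Prod.swap_injective.injOn))
  have h2 : HasHSum (fun p : ℤ × ℤ => B (N - p.1) (C (p.1 - p.2) (D p.2 w)))
      (mul B (mul C D hD) (hC.mul hD) N w) := by
    refine HasHSum.prod (fun k => ?_) (fun q => (mul_hasHSum C hD q w).map (B (N - q)))
      (mul_hasHSum B (hC.mul hD) N w)
    refine ((hC.pair_finite (hD w) (fun m n => B (N - n - m)) k).preimage
      (f := fun p : ℤ × ℤ => (p.1 - p.2, p.2)) ?_).subset ?_
    · rintro ⟨a, b⟩ _ ⟨c, d⟩ _ h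
      simp only [Prod.mk.injEq] at h ⊢
      omega
    · rintro ⟨a, b⟩ h
      simpa using h
  let e : ℤ × ℤ ≃ ℤ × ℤ :=
    { toFun := fun p => (p.2, p.1 - p.2)
      invFun := fun p => (p.1 + p.2, p.1)
      left_inv := fun p => by simp
      right_inv := fun p => by simp }
  refine HasHSum.unique ?_ h2
  convert h1.equiv e using 2 with p
  simp [e]

theorem mul_comm' {C D : OpSeries} (hC : LocFinite C) (hD : LocFinite D)
    (h : ∀ m n, Commute (C m) (D n)) : mul C D hD = mul D C hC := by
  funext N
  refine LinearMap.ext fun w => ?_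
  refine HasHSum.unique (mul_hasHSum C hD N w) ?_
  convert (mul_hasHSum D hC N w).equiv (Equiv.subLeft N) using 2 with n
  simp only [Equiv.subLeft_apply, sub_sub_cancel]
  exact LinearMap.congr_fun (h (N - n) n).eq w

theorem mul_left_end (T : FockEnd) (B : OpSeries) {C : OpSeries} (hC : LocFinite C) :
    mul (fun n => T * B n) C hC = fun n => T * mul B C hC n := by
  funext N
  refine LinearMap.ext fun w => ?_
  exact HasHSum.unique (mul_hasHSum _ hC N w) ((mul_hasHSum B hC N w).map T)

/-! ### Operators on `F_i` with coefficients in `End V` -/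

theorem series_smul_def (c : PowerSeries ℂ) (w : Fock) :
    c • w = PowerSeries.map (algebraMap ℂ V) c * w := rfl

theorem series_smul_zero (c : PowerSeries ℂ) : c • (0 : Fock) = 0 := by
  rw [series_smul_def, mul_zero]

theorem zero_series_smul (w : Fock) : (0 : PowerSeries ℂ) • w = 0 := by
  rw [series_smul_def, map_zero, zero_mul]

theorem series_smul_smul (c d : PowerSeries ℂ) (w : Fock) : c • d • w = (c * d) • w := by
  simp only [series_smul_def, map_mul, mul_assoc]

theorem sub_series_smul (c d : PowerSeries ℂ) (w : Fock) : (c - d) • w = c • w - d • w := by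
  simp only [series_smul_def, map_sub, sub_mul]

theorem sum_series_smul {ι : Type} (s : Finset ι) (c : ι → PowerSeries ℂ) (w : Fock) :
    (∑ x ∈ s, c x) • w = ∑ x ∈ s, c x • w := by
  simp only [series_smul_def, map_sum, Finset.sum_mul]

theorem coeff_toEnd (T : PowerSeries (Module.End ℂ V)) (w : Fock) (n : ℕ) :
    coeff n (toEnd T w) = ∑ p ∈ Finset.HasAntidiagonal.antidiagonal n,
      (coeff p.1 T) (coeff p.2 w) := by
  simp [toEnd]

theorem coeff_toEnd_C (T : PowerSeries (Module.End ℂ V)) (v : V) (n : ℕ) :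
    coeff n (toEnd T (C v)) = coeff n T v := by
  rw [coeff_toEnd, Finset.sum_eq_single (n, 0)]
  · simp
  · rintro ⟨a, b⟩ hab hne
    have hb : b ≠ 0 := by
      rintro rfl
      simp at hab
      exact hne (by simp [hab])
    simp [coeff_C, hb]
  · simp

/-- Operators on `F_i` are determined by their values on `V`. -/
theorem fockEnd_ext {S T : FockEnd}
    (h : ∀ (κ : ℤ) (f : CreationAlg), S (C (AddMonoidAlgebra.single κ f)) =
      T (C (AddMonoidAlgebra.single κ f))) : S = T := by
  have hC : ∀ v : V, (S - T) (C v) = 0 := fun v => by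
    induction v using AddMonoidAlgebra.induction_linear with
    | zero => simp
    | add v w hv hw => rw [map_add, map_add, hv, hw, add_zero]
    | single κ f => rw [LinearMap.sub_apply, h, sub_self]
  have hpoly : ∀ n (w : Fock), (S - T) (∑ l ∈ Finset.range n,
      (X : PowerSeries ℂ) ^ l • (C (coeff l w) : Fock)) = 0 := fun n w => by
    rw [map_sum]
    exact Finset.sum_eq_zero fun l _ => by rw [map_smul, hC, series_smul_zero]
  refine LinearMap.ext fun w => sub_eq_zero.1 ?_
  rw [← LinearMap.sub_apply]
  ext1 k
  rw [map_zero, ← sub_zero ((S - T) w), ← hpoly (k + 1) w, ← map_sub]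
  refine coeff_end_eq_zero _ fun l hl => ?_
  have hX : ∀ j (v : V), (X : PowerSeries ℂ) ^ j • (C v : Fock) = monomial j v := fun j v => by
    have : (X : PowerSeries ℂ) ^ j • (C v : Fock) =
      PowerSeries.map (algebraMap ℂ V) (X ^ j) * C v := rfl
    ext1 n
    rw [this, map_pow, map_X, coeff_monomial, coeff_X_pow_mul']
    split_ifs with h1 h2 h2
    · rw [h2, Nat.sub_self, coeff_zero_C]
    · rw [coeff_C, if_neg (by omega)]
    · omega
    · rfl
  simp only [hX, map_sub, map_sum, coeff_monomial]
  rw [Finset.sum_ite_eq, if_pos (by simpa using Nat.lt_succ_of_le hl), sub_self]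

theorem toEnd_one : toEnd 1 = 1 := by
  refine fockEnd_ext fun κ f => ?_
  ext1 k
  rw [coeff_toEnd_C, coeff_one, Module.End.one_apply, coeff_C]
  split_ifs <;> simp

theorem toEnd_mul (S T : PowerSeries (Module.End ℂ V)) : toEnd (S * T) = toEnd S * toEnd T := by
  refine fockEnd_ext fun κ f => ?_
  ext1 k
  rw [coeff_toEnd_C, Module.End.mul_apply, coeff_toEnd, coeff_mul, LinearMap.sum_apply]
  exact Finset.sum_congr rfl fun p _ => by rw [coeff_toEnd_C, Module.End.mul_apply]

theorem toEnd_add (S T : PowerSeries (Module.End ℂ V)) : toEnd (S + T) = toEnd S + toEnd T := by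
  refine fockEnd_ext fun κ f => ?_
  ext1 k
  rw [coeff_toEnd_C, LinearMap.add_apply, map_add, map_add, coeff_toEnd_C, coeff_toEnd_C,
    LinearMap.add_apply]

/-- The action of `End_ℂ(V)[[h]]` on `F_i` as a ring homomorphism. -/
def toEndHom : PowerSeries (Module.End ℂ V) →+* FockEnd where
  toFun := toEnd
  map_one' := toEnd_one
  map_mul' := toEnd_mul
  map_zero' := by
    refine fockEnd_ext fun κ f => ?_
    ext1 k
    rw [coeff_toEnd_C]; rfl
  map_add' := toEnd_add

theorem toEndHom_apply (S : PowerSeries (Module.End ℂ V)) : toEndHom S = toEnd S := rfl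

theorem commute_of_coeff {A : Type} [Semiring A] {f g : PowerSeries A}
    (h : ∀ m n, Commute (coeff m f) (coeff n g)) : Commute f g := by
  ext1 n
  rw [coeff_mul, coeff_mul, ← Finset.Nat.sum_antidiagonal_swap]
  exact Finset.sum_congr rfl fun p _ => (h p.2 p.1).eq

theorem toEnd_commute {S T : PowerSeries (Module.End ℂ V)}
    (h : ∀ m n, Commute (coeff m S) (coeff n T)) : Commute (toEnd S) (toEnd T) :=
  (commute_of_coeff h).map toEndHom

theorem toEnd_X_pow (n : ℕ) : toEnd (X ^ n) = (X : PowerSeries ℂ) ^ n • (1 : FockEnd) := by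
  refine fockEnd_ext fun κ f => ?_
  ext1 k
  rw [coeff_toEnd_C, LinearMap.smul_apply, Module.End.one_apply, coeff_series_smul,
    coeff_X_pow, Finset.sum_eq_single (k, 0)]
  · simp only [coeff_X_pow]
    split_ifs <;> simp
  · rintro ⟨a, b⟩ hab hne
    have hb : b ≠ 0 := by
      rintro rfl
      simp at hab
      exact hne (by simp [hab])
    simp [coeff_C, hb]
  · simp

/-- Products of series in `u⁻¹` and `h` are the products of the operator series. -/
theorem ofUInv_mul (f g : PowerSeries (PowerSeries (Module.End ℂ V)))
    (hg : LocFinite (ofUInv g)) : mul (ofUInv f) (ofUInv g) hg = ofUInv (f * g) := by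
  funext N
  refine LinearMap.ext fun w => ?_
  refine HasHSum.unique (mul_hasHSum _ hg N w) ?_
  by_cases hN : N ≤ 0
  · convert hasHSum_sum (f := fun n => ofUInv f (N - n) (ofUInv g n w))
      ((Finset.HasAntidiagonal.antidiagonal (-N).toNat).image fun p => -(p.2 : ℤ)) ?_
    · rw [Finset.sum_image]
      · simp only [ofUInv, if_pos hN, coeff_mul]
        rw [← toEndHom_apply, map_sum, LinearMap.sum_apply]
        refine Finset.sum_congr rfl fun p hp => ?_
        rw [Finset.HasAntidiagonal.mem_antidiagonal] at hp
        rw [if_pos (by omega), if_pos (by omega), map_mul, Module.End.mul_apply,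
          toEndHom_apply, toEndHom_apply]
        rw [show (-(N - -(p.2 : ℤ))).toNat = p.1 by omega,
          show (-(-(p.2 : ℤ))).toNat = p.2 by omega]
      · rintro ⟨a, b⟩ hp ⟨c, d⟩ hq h
        simp at hp hq h
        ext <;> simp <;> omega
    · intro n hn
      simp only [ofUInv]
      by_cases h1 : n ≤ 0 ∧ N - n ≤ 0
      · refine absurd ?_ hn
        rw [Finset.mem_image]
        exact ⟨((n - N).toNat, (-n).toNat), by simp; omega, by simp; omega⟩
      · by_cases h2 : n ≤ 0
        · rw [if_neg (show ¬ N - n ≤ 0 by tauto)]; simp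
        · rw [if_neg h2]; simp
  · convert HasHSum.zero with n
    · simp only [ofUInv]
      by_cases h2 : n ≤ 0
      · rw [if_neg (show ¬ N - n ≤ 0 by omega)]; simp
      · rw [if_neg h2]; simp
    · simp [ofUInv, hN]

/-! ### Diagonal operator series -/

/-- The operator multiplying `f ⊗ e^{κ α + λ_i}` by the scalar `φ κ`. -/
def diagInt (φ : ℤ → ℂ) : Module.End ℂ V where
  toFun v := AddMonoidAlgebra.ofCoeff
    (Finsupp.onFinset v.coeff.support (fun κ => φ κ • v.coeff κ)
      (fun κ hκ => by
        rw [Finsupp.mem_support_iff]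
        intro h0
        exact hκ (by rw [h0, smul_zero])))
  map_add' v w := by ext1; ext1 κ; simp
  map_smul' c v := by ext1; ext1 κ; simp [smul_comm c]

theorem diag_eq_diagInt (i : Fin 2) (φ : (Fin 2 → ℂ) → ℂ) :
    diag i φ = diagInt fun κ => φ (weight i κ) := rfl

theorem diagInt_single (φ : ℤ → ℂ) (κ : ℤ) (f : CreationAlg) :
    diagInt φ (AddMonoidAlgebra.single κ f) = φ κ • AddMonoidAlgebra.single κ f := by
  ext1; ext1 κ'
  simp only [diagInt, LinearMap.coe_mk, AddHom.coe_mk, Finsupp.onFinset_apply,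
    AddMonoidAlgebra.coeff_single, AddMonoidAlgebra.coeff_smul, Finsupp.smul_apply,
    Finsupp.single_apply]
  split_ifs with h
  · rw [h]
  · simp

theorem eAlpha_single (κ : ℤ) (f : CreationAlg) :
    eAlpha (AddMonoidAlgebra.single κ f) = AddMonoidAlgebra.single (κ + 1) f := by
  ext1
  simp [eAlpha, Finsupp.mapDomain_single, -LaurentPolynomial.single_eq_C_mul_T]

theorem onCreation_single (φ : CreationAlg →ₗ[ℂ] CreationAlg) (κ : ℤ) (f : CreationAlg) :
    onCreation φ (AddMonoidAlgebra.single κ f) = AddMonoidAlgebra.single κ (φ f) := by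
  ext1
  simp [onCreation, -LaurentPolynomial.single_eq_C_mul_T]

theorem endV_ext {S T : Module.End ℂ V}
    (h : ∀ (κ : ℤ) (f : CreationAlg), S (AddMonoidAlgebra.single κ f) =
      T (AddMonoidAlgebra.single κ f)) : S = T := by
  refine LinearMap.ext fun v => ?_
  induction v using AddMonoidAlgebra.induction_linear with
  | zero => simp
  | add v w hv hw => rw [map_add, map_add, hv, hw]
  | single κ f => exact h κ f

theorem onCreation_commute_diagInt (φ : CreationAlg →ₗ[ℂ] CreationAlg) (ψ : ℤ → ℂ) :
    Commute (onCreation φ) (diagInt ψ) := by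
  refine endV_ext fun κ f => ?_
  simp only [Module.End.mul_apply, diagInt_single, onCreation_single, map_smul]

theorem onCreation_commute_eAlpha (φ : CreationAlg →ₗ[ℂ] CreationAlg) :
    Commute (onCreation φ) eAlpha := by
  refine endV_ext fun κ f => ?_
  simp only [Module.End.mul_apply, eAlpha_single, onCreation_single]

/-- The coefficient of `uⁿ` in `u^p t(h / u)`, as a series in `h`. -/
def modeCoeff (p : ℤ) (t : PowerSeries ℂ) (n : ℤ) : PowerSeries ℂ :=
  if n ≤ p then monomial (p - n).toNat (coeff (p - n).toNat t) else 0

theorem modeCoeff_of_eq {p n : ℤ} (t : PowerSeries ℂ) (k : ℕ) (h : p = n + k) :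
    modeCoeff p t n = monomial k (coeff k t) := by
  subst h
  simp [modeCoeff]

theorem modeCoeff_of_lt {p n : ℤ} (t : PowerSeries ℂ) (h : p < n) : modeCoeff p t n = 0 := by
  rw [modeCoeff, if_neg (by omega)]

/-- The operator series `f ⊗ e^{κ α + λ_i} ↦ u^{p κ} t_κ(h / u) f ⊗ e^{κ α + λ_i}`. -/
def mode (p : ℤ → ℤ) (t : ℤ → PowerSeries ℂ) : OpSeries := fun n =>
  toEnd (PowerSeries.mk fun k => diagInt fun κ =>
    if p κ = n + k then coeff k (t κ) else 0)

theorem mode_single (p : ℤ → ℤ) (t : ℤ → PowerSeries ℂ) (n κ : ℤ) (f : CreationAlg) :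
    mode p t n (C (AddMonoidAlgebra.single κ f)) =
      modeCoeff (p κ) (t κ) n • (C (AddMonoidAlgebra.single κ f) : Fock) := by
  ext1 k
  rw [mode, coeff_toEnd_C, coeff_mk, diagInt_single, coeff_series_smul,
    Finset.sum_eq_single (k, 0)]
  · simp only [coeff_zero_C]
    congr 1
    by_cases h : n ≤ p κ
    · obtain ⟨l, hl⟩ := Int.le.dest h
      rw [modeCoeff_of_eq _ l hl.symm, coeff_monomial]
      by_cases hlk : k = l
      · subst hlk; rw [if_pos rfl, if_pos hl.symm]
      · rw [if_neg hlk, if_neg (by omega)]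
    · rw [modeCoeff_of_lt _ (by omega), if_neg (by omega), map_zero]
  · rintro ⟨a, b⟩ hab hne
    have hb : b ≠ 0 := by
      rintro rfl
      simp at hab
      exact hne (by simp [hab])
    simp [coeff_C, hb]
  · simp

theorem mode_locFinite (p : ℤ → ℤ) (t : ℤ → PowerSeries ℂ) : LocFinite (mode p t) := by
  refine locFinite_of _ (fun n => rfl) fun v k => ?_
  refine (v.coeff.support.finite_toSet.biUnion
    (t := fun κ => {n : ℤ | p κ = n + (k : ℤ)}) fun κ _ => ?_).subset ?_
  · refine Set.Subsingleton.finite fun n hn n' hn' => ?_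
    simp only [Set.mem_ofPred_eq] at hn hn'
    omega
  · intro n hn
    by_contra hcon
    simp only [Set.mem_iUnion, Set.mem_ofPred_eq, not_exists] at hcon
    refine hn (AddMonoidAlgebra.ext (Finsupp.ext fun κ => ?_))
    by_cases hκ : κ ∈ v.coeff.support
    · simp [diagInt, hcon κ hκ]
    · simp [diagInt, Finsupp.notMem_support_iff.1 hκ]

theorem mode_commute (p q : ℤ → ℤ) (s t : ℤ → PowerSeries ℂ) (m n : ℤ) :
    Commute (mode p s m) (mode q t n) := by
  refine fockEnd_ext fun κ f => ?_
  simp only [Module.End.mul_apply, mode_single, map_smul]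
  rw [series_smul_smul, series_smul_smul, mul_comm]

theorem mode_mul (p q : ℤ → ℤ) (s t : ℤ → PowerSeries ℂ) :
    mul (mode p s) (mode q t) (mode_locFinite q t) = mode (p + q) (s * t) := by
  funext N
  refine fockEnd_ext fun κ f => ?_
  refine HasHSum.unique (mul_hasHSum _ (mode_locFinite q t) N _) ?_
  simp only [mode_single, map_smul, series_smul_smul, Pi.add_apply, Pi.mul_apply]
  generalize p κ = p
  generalize q κ = q
  generalize s κ = s
  generalize t κ = t
  by_cases hN : N ≤ p + q
  · obtain ⟨k, hk⟩ := Int.le.dest hN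
    have h := hasHSum_sum (f := fun n => (modeCoeff q t n * modeCoeff p s (N - n)) •
      (C (AddMonoidAlgebra.single κ f) : Fock))
      ((Finset.HasAntidiagonal.antidiagonal k).image fun x => q - (x.2 : ℤ)) ?_
    · convert h using 1
      rw [Finset.sum_image, ← sum_series_smul]
      · congr 1
        rw [modeCoeff_of_eq _ k hk.symm, coeff_mul, map_sum]
        refine Finset.sum_congr rfl fun x hx => ?_
        rw [Finset.HasAntidiagonal.mem_antidiagonal] at hx
        rw [modeCoeff_of_eq t x.2 (by omega), modeCoeff_of_eq s x.1 (by omega),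
          monomial_mul_monomial, ← hx, mul_comm, add_comm]
      · rintro ⟨a, b⟩ hp ⟨c, d⟩ hq h
        simp at hp hq h
        ext <;> simp <;> omega
    · intro n hn
      by_cases h1 : n ≤ q ∧ N - n ≤ p
      · refine absurd ?_ hn
        rw [Finset.mem_image]
        exact ⟨((p - (N - n)).toNat, (q - n).toNat), by simp; omega, by simp; omega⟩
      · by_cases h2 : n ≤ q
        · rw [modeCoeff_of_lt s (by omega)]; simp [zero_series_smul]
        · rw [modeCoeff_of_lt t (by omega)]; simp [zero_series_smul]
  · rw [modeCoeff_of_lt _ (by omega)]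
    convert HasHSum.zero with n
    · by_cases h2 : n ≤ q
      · rw [modeCoeff_of_lt s (by omega)]; simp [zero_series_smul]
      · rw [modeCoeff_of_lt t (by omega)]; simp [zero_series_smul]
    · rw [zero_series_smul]

theorem mode_mul_eAlpha (p : ℤ → ℤ) (t : ℤ → PowerSeries ℂ) (n : ℤ) :
    mode p t n * toEnd (C eAlpha) =
      toEnd (C eAlpha) * mode (fun κ => p (κ + 1)) (fun κ => t (κ + 1)) n := by
  refine fockEnd_ext fun κ f => ?_
  have h : toEnd (C eAlpha) (C (AddMonoidAlgebra.single κ f)) =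
      C (AddMonoidAlgebra.single (κ + 1) f) := by
    ext1 k
    rw [coeff_toEnd_C, coeff_C, coeff_C]
    split_ifs
    · exact eAlpha_single κ f
    · simp
  simp only [Module.End.mul_apply, mode_single, map_smul, h]

/-- Multiplication of `u^p t(h / u)` by `u² - h² = u² (1 - (h / u)²)`. -/
theorem mode_shift (p : ℤ → ℤ) (t : ℤ → PowerSeries ℂ) (n : ℤ) :
    mode (fun κ => p κ + 2) (fun κ => t κ * (1 - X ^ 2)) n =
      mode p t (n - 2) - (X : PowerSeries ℂ) ^ 2 • mode p t n := by
  refine fockEnd_ext fun κ f => ?_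
  simp only [LinearMap.sub_apply, LinearMap.smul_apply, mode_single, series_smul_smul,
    ← sub_series_smul]
  congr 1
  generalize p κ = p
  generalize t κ = t
  by_cases hn : n ≤ p + 2
  · obtain ⟨k, hk⟩ := Int.le.dest hn
    rw [modeCoeff_of_eq _ k hk.symm, modeCoeff_of_eq _ k (by omega), mul_sub, mul_one, map_sub,
      map_sub]
    congr 1
    by_cases h2 : 2 ≤ k
    · obtain ⟨l, rfl⟩ := Nat.exists_eq_add_of_le' h2
      rw [coeff_mul_X_pow, modeCoeff_of_eq t l (by push_cast at hk; omega), X_pow_eq,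
        monomial_mul_monomial, one_mul, add_comm]
    · rw [modeCoeff_of_lt t (by omega), coeff_mul_X_pow', if_neg h2]
      simp
  · rw [modeCoeff_of_lt _ (by omega), modeCoeff_of_lt _ (by omega), modeCoeff_of_lt _ (by omega)]
    simp

/-! ### The zero modes -/

/-- The binomial series `(1 + c x)^s`. -/
def binSeries (s c : ℂ) : PowerSeries ℂ := rescale c (binomialSeries ℂ s)

theorem coeff_binSeries (s c : ℂ) (k : ℕ) : coeff k (binSeries s c) = binomial s c k := by
  simp [binSeries, binomial, mul_comm]

theorem binSeries_add (r s c : ℂ) : binSeries (r + s) c = binSeries r c * binSeries s c := by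
  simp [binSeries]

theorem binSeries_zero (c : ℂ) : binSeries 0 c = 1 := by
  simp [binSeries]

theorem binSeries_one (c : ℂ) : binSeries 1 c = 1 + C c * X := by
  have h := binomialSeries_nat (R := ℂ) (A := ℂ) 1
  rw [binSeries, show (1 : ℂ) = ((1 : ℕ) : ℂ) by simp, h]
  simp [rescale_X]

theorem zeroMode_eq_mode (i : Fin 2) (p q : (Fin 2 → ℂ) → ℂ) (c : ℂ) (P : ℤ → ℤ)
    (hP : ∀ κ, p (weight i κ) = P κ) :
    zeroMode i p q c = mode P fun κ => binSeries (q (weight i κ)) c := by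
  funext n
  simp only [zeroMode, mode, diag_eq_diagInt, coeff_binSeries, hP]
  congr! 6
  norm_cast

theorem form_alpha_weight (i : Fin 2) (κ : ℤ) :
    form alpha (weight i κ) = ((2 * κ + (i : ℕ) : ℤ) : ℂ) := by
  fin_cases i
  · simp [form, weight, alpha, lam]; ring
  · simp [form, weight, alpha, lam]; ring

/-! ### Formal exponentials -/

section FormalExp

variable {A B : Type} [Ring A] [Algebra ℂ A] [Ring B] [Algebra ℂ B]

theorem coeff_pow_eq_zero {R : Type} [Ring R] {F : PowerSeries (PowerSeries R)}
    (hF : coeff 0 (coeff 0 F) = 0) (n m k : ℕ) (h : m + k < n) : coeff k (coeff m (F ^ n)) = 0 := by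
  induction n generalizing m k with
  | zero => omega
  | succ n ih =>
    rw [pow_succ, coeff_mul, map_sum]
    refine Finset.sum_eq_zero fun p hp => ?_
    rw [coeff_mul]
    refine Finset.sum_eq_zero fun q hq => ?_
    rw [Finset.HasAntidiagonal.mem_antidiagonal] at hp hq
    by_cases h0 : p.2 = 0 ∧ q.2 = 0
    · rw [h0.1, h0.2, hF, mul_zero]
    · rw [ih _ _ (by omega), zero_mul]

theorem coeff_formalExp {F : PowerSeries (PowerSeries A)} (hF : coeff 0 (coeff 0 F) = 0)
    {m k L : ℕ} (h : m + k < L) : coeff k (coeff m (formalExp F)) =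
      ∑ n ∈ Finset.range L, ((n.factorial : ℂ)⁻¹) • coeff k (coeff m (F ^ n)) := by
  rw [formalExp, coeff_mk, coeff_mk]
  refine Finset.sum_subset (Finset.range_mono (by omega)) fun n _ hn => ?_
  rw [coeff_pow_eq_zero hF _ _ _ (by simpa using hn), smul_zero]

theorem coeff_formalExp_mul {F : PowerSeries (PowerSeries A)} (hF : coeff 0 (coeff 0 F) = 0)
    (G : PowerSeries (PowerSeries A)) {m k L : ℕ} (h : m + k < L) :
    coeff k (coeff m (formalExp F * G)) =
      ∑ n ∈ Finset.range L, ((n.factorial : ℂ)⁻¹) • coeff k (coeff m (F ^ n * G)) := by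
  simp only [coeff_mul, map_sum, Finset.smul_sum]
  symm
  rw [Finset.sum_comm]
  refine Finset.sum_congr rfl fun p hp => ?_
  rw [Finset.sum_comm]
  refine Finset.sum_congr rfl fun q hq => ?_
  symm
  rw [Finset.HasAntidiagonal.mem_antidiagonal] at hp hq
  rw [coeff_formalExp hF (L := L) (by omega), Finset.sum_mul]
  simp only [smul_mul_assoc]

theorem coeff_mul_formalExp {F : PowerSeries (PowerSeries A)} (hF : coeff 0 (coeff 0 F) = 0)
    (G : PowerSeries (PowerSeries A)) {m k L : ℕ} (h : m + k < L) :
    coeff k (coeff m (G * formalExp F)) =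
      ∑ n ∈ Finset.range L, ((n.factorial : ℂ)⁻¹) • coeff k (coeff m (G * F ^ n)) := by
  simp only [coeff_mul, map_sum, Finset.smul_sum]
  symm
  rw [Finset.sum_comm]
  refine Finset.sum_congr rfl fun p hp => ?_
  rw [Finset.sum_comm]
  refine Finset.sum_congr rfl fun q hq => ?_
  symm
  rw [Finset.HasAntidiagonal.mem_antidiagonal] at hp hq
  rw [coeff_formalExp hF (L := L) (by omega), Finset.mul_sum]
  simp only [mul_smul_comm]

theorem pow_succ_mul_of_commutator {R : Type} [Ring R] {F G c : R} (h : F * G = G * F + c)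
    (hc : Commute c F) (n : ℕ) :
    F ^ (n + 1) * G = G * F ^ (n + 1) + (n + 1) • (c * F ^ n) := by
  induction n with
  | zero => simp [h]
  | succ n ih =>
    have h1 : F * (c * F ^ n) = c * F ^ (n + 1) := by
      rw [← mul_assoc, ← hc.eq, mul_assoc, pow_succ']
    rw [pow_succ' F (n + 1), mul_assoc, ih, mul_add, ← mul_assoc, h, mul_smul_comm, h1,
      succ_nsmul _ (n + 1), add_mul, mul_assoc]
    abel

theorem inv_factorial_succ_smul (n : ℕ) (x : A) :
    (((n + 1).factorial : ℂ)⁻¹) • ((n + 1) • x) = ((n.factorial : ℂ)⁻¹) • x := by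
  rw [← Nat.cast_smul_eq_nsmul ℂ (n + 1) x, smul_smul, Nat.factorial_succ]
  congr 1
  have h1 : ((n + 1 : ℕ) : ℂ) ≠ 0 := Nat.cast_ne_zero.2 (Nat.succ_ne_zero n)
  have h2 : (n.factorial : ℂ) ≠ 0 := Nat.cast_ne_zero.2 (Nat.factorial_ne_zero n)
  push_cast at h1 ⊢
  field_simp

/-- If `[F, G] = c` commutes with `F`, then `e^F G = (G + c) e^F`. -/
theorem formalExp_mul_of_commutator {F G c : PowerSeries (PowerSeries A)}
    (hF : coeff 0 (coeff 0 F) = 0) (h : F * G = G * F + c) (hc : Commute c F) :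
    formalExp F * G = (G + c) * formalExp F := by
  ext m k
  rw [add_mul, map_add, map_add, coeff_formalExp_mul hF G (L := m + k + 1 + 1) (by omega),
    coeff_mul_formalExp hF G (L := m + k + 1 + 1) (by omega),
    coeff_mul_formalExp hF c (L := m + k + 1) (by omega),
    Finset.sum_range_succ' _ (m + k + 1), Finset.sum_range_succ' _ (m + k + 1)]
  simp only [pow_succ_mul_of_commutator h hc, map_add, map_nsmul, smul_add,
    inv_factorial_succ_smul, Finset.sum_add_distrib, pow_zero, one_mul, mul_one]
  abel

theorem commute_coeff_formalExp {F : PowerSeries (PowerSeries A)}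
    (hF : coeff 0 (coeff 0 F) = 0) {x : A} (hx : ∀ m k, Commute x (coeff k (coeff m F)))
    (m k : ℕ) : Commute x (coeff k (coeff m (formalExp F))) := by
  have h : F * C (C x) = C (C x) * F + 0 := by
    ext m k
    simpa using (hx m k).eq.symm
  have h2 := formalExp_mul_of_commutator hF h (Commute.zero_left _)
  have h3 := congrArg (fun G => coeff k (coeff m G)) h2
  simp only [add_zero, coeff_mul_C, coeff_C_mul] at h3
  exact h3.symm

theorem formalExp_map (φ : A →ₐ[ℂ] B) (F : PowerSeries (PowerSeries A)) :
    formalExp (map (map (φ : A →+* B)) F) = map (map (φ : A →+* B)) (formalExp F) := by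
  ext m k
  simp only [formalExp, coeff_mk, ← map_pow, coeff_map, map_sum]
  exact Finset.sum_congr rfl fun n _ => (map_smul φ _ _).symm

end FormalExp

/-- The chain rule `(e^F)' = F' e^F`. -/
theorem derivative_formalExp {A : Type} [CommRing A] [Algebra ℂ A]
    {F : PowerSeries (PowerSeries A)} (hF : coeff 0 (coeff 0 F) = 0) :
    d⁄dX (PowerSeries A) (formalExp F) = d⁄dX (PowerSeries A) F * formalExp F := by
  ext m k
  have h1 : coeff k (coeff m (d⁄dX (PowerSeries A) (formalExp F))) =
      ∑ n ∈ Finset.range (m + k + 1 + 1),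
        ((n.factorial : ℂ)⁻¹) • coeff k (coeff m (d⁄dX (PowerSeries A) (F ^ n))) := by
    have h2 : ∀ G : PowerSeries (PowerSeries A), coeff k (coeff m (d⁄dX (PowerSeries A) G)) =
        (m + 1) • coeff k (coeff (m + 1) G) := fun G => by
      rw [coeff_derivative, ← map_nsmul, nsmul_eq_mul, mul_comm, Nat.cast_succ]
    simp only [h2]
    rw [coeff_formalExp hF (L := m + k + 1 + 1) (by omega), Finset.smul_sum]
    exact Finset.sum_congr rfl fun n _ => smul_comm _ _ _
  rw [h1, coeff_mul_formalExp hF _ (L := m + k + 1) (by omega), Finset.sum_range_succ']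
  have h3 : ∀ n, d⁄dX (PowerSeries A) (F ^ (n + 1)) =
      (n + 1) • (d⁄dX (PowerSeries A) F * F ^ n) := fun n => by
    rw [derivative_pow, Nat.add_sub_cancel, nsmul_eq_mul]
    ring
  simp only [h3, map_nsmul, inv_factorial_succ_smul]
  simp

theorem derivative_mul {R : Type} [CommRing R] (F G : PowerSeries R) :
    d⁄dX R (F * G) = F * d⁄dX R G + d⁄dX R F * G := by
  rw [Derivation.leibniz, smul_eq_mul, smul_eq_mul, mul_comm G]

theorem derivative_map {R S : Type} [CommRing R] [CommRing S] (φ : R →+* S)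
    (F : PowerSeries R) : d⁄dX S (map φ F) = map φ (d⁄dX R F) := by
  ext n
  simp [coeff_derivative]

/-- A first order linear differential equation `Y' = a Y` has at most one solution with given
constant term. -/
theorem eq_of_recursion {R : Type} [Ring R]
    (hR : ∀ (n : ℕ) (x y : R), (n + 1) • x = (n + 1) • y → x = y) {a Y Z : ℕ → R}
    (hY : ∀ j, (j + 1) • Y (j + 1) =
      ∑ p ∈ Finset.HasAntidiagonal.antidiagonal j, a p.1 * Y p.2)
    (hZ : ∀ j, (j + 1) • Z (j + 1) =
      ∑ p ∈ Finset.HasAntidiagonal.antidiagonal j, a p.1 * Z p.2)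
    (h0 : Y 0 = Z 0) (j : ℕ) : Y j = Z j := by
  induction j using Nat.strong_induction_on with
  | _ j ih =>
    cases j with
    | zero => exact h0
    | succ j =>
      refine hR j _ _ ?_
      rw [hY, hZ]
      refine Finset.sum_congr rfl fun p hp => ?_
      rw [Finset.HasAntidiagonal.mem_antidiagonal] at hp
      rw [ih p.2 (by omega)]

theorem recursion_of_derivative {R : Type} [CommRing R] {F G : PowerSeries R}
    (h : d⁄dX R F = G * F) (j : ℕ) : (j + 1) • coeff (j + 1) F =
      ∑ p ∈ Finset.HasAntidiagonal.antidiagonal j, coeff p.1 G * coeff p.2 F := by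
  rw [← coeff_mul, ← h, coeff_derivative, nsmul_eq_mul, mul_comm, Nat.cast_succ]

/-- Multiplication by a positive integer is injective on series over a `ℂ`-algebra. -/
theorem nsmul_series_injective {A : Type} [Ring A] [Algebra ℂ A] (n : ℕ)
    (F G : PowerSeries (PowerSeries A)) (h : (n + 1) • F = (n + 1) • G) : F = G := by
  ext m k
  have h1 := congrArg (fun F => coeff k (coeff m F)) h
  simp only [map_nsmul] at h1
  rw [← Nat.cast_smul_eq_nsmul ℂ, ← Nat.cast_smul_eq_nsmul ℂ] at h1
  have h2 : ((n + 1 : ℕ) : ℂ) ≠ 0 := Nat.cast_ne_zero.2 (Nat.succ_ne_zero n)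
  simpa only [smul_smul, inv_mul_cancel₀ h2, one_smul] using congrArg (((n + 1 : ℕ) : ℂ)⁻¹ • ·) h1

/-! ### Creation operators -/

/-- The algebra of creation operators, as a type of its own: its only algebraic structure is that
of a commutative `ℂ`-algebra, so that instances on power series over it are found without
unfolding polynomials. -/
def CreationRing : Type := CreationAlg

instance : CommRing CreationRing := inferInstanceAs (CommRing CreationAlg)

instance : Algebra ℂ CreationRing := inferInstanceAs (Algebra ℂ CreationAlg)

/-- The identification of `CreationRing` with the polynomial algebra it stands for. -/
def creationEquiv : CreationRing ≃ₐ[ℂ] CreationAlg :=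
  (AlgEquiv.refl : CreationAlg ≃ₐ[ℂ] CreationAlg)

/-- The generator `a_j(-s)`. -/
def creationVar (j : Fin 2) (s : ℕ) : CreationRing :=
  creationEquiv.symm (MvPolynomial.X (j, s.toPNat'))

/-- The multiplication operators `f ⊗ e^μ ↦ g f ⊗ e^μ`, as an algebra homomorphism in `g`. -/
def creationHom : CreationRing →ₐ[ℂ] Module.End ℂ V where
  toFun g := onCreation (LinearMap.mulLeft ℂ (creationEquiv g))
  map_one' := endV_ext fun κ f => by
    rw [onCreation_single, map_one, LinearMap.mulLeft_apply, one_mul, Module.End.one_apply]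
  map_mul' g g' := endV_ext fun κ f => by
    rw [Module.End.mul_apply, onCreation_single, onCreation_single, onCreation_single, map_mul,
      LinearMap.mulLeft_apply, LinearMap.mulLeft_apply, LinearMap.mulLeft_apply, mul_assoc]
  map_zero' := endV_ext fun κ f => by
    rw [onCreation_single, LinearMap.zero_apply, map_zero, LinearMap.mulLeft_apply, zero_mul,
      AddMonoidAlgebra.single_zero]
  map_add' g g' := endV_ext fun κ f => by
    rw [LinearMap.add_apply, onCreation_single, onCreation_single, onCreation_single, map_add,
      LinearMap.mulLeft_apply, LinearMap.mulLeft_apply, LinearMap.mulLeft_apply, add_mul,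
      AddMonoidAlgebra.single_add]
  commutes' c := endV_ext fun κ f => by
    rw [onCreation_single, Module.algebraMap_end_apply, AddMonoidAlgebra.smul_single,
      AlgEquiv.commutes, LinearMap.mulLeft_apply, Algebra.smul_def]

theorem creationHom_apply (g : CreationRing) :
    creationHom g = onCreation (LinearMap.mulLeft ℂ (creationEquiv g)) := rfl

theorem creationHom_creationVar (j : Fin 2) (s : ℕ) :
    creationHom (creationVar j s) =
      onCreation (LinearMap.mulLeft ℂ (MvPolynomial.X (j, s.toPNat'))) := by
  rw [creationHom_apply, creationVar, AlgEquiv.apply_symm_apply]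

/-- Series with coefficients in the algebra of creation operators, as operator series. -/
abbrev creationMap : PowerSeries (PowerSeries CreationRing) →+*
    PowerSeries (PowerSeries (Module.End ℂ V)) :=
  PowerSeries.map (PowerSeries.map (creationHom : CreationRing →+* Module.End ℂ V))

/-- `∑_{r > 0} (a_j(-r) / r) (u + c h)ʳ` with coefficients in the algebra of creation
operators. -/
def creationSum (j : Fin 2) (c : ℂ) : PowerSeries (PowerSeries CreationRing) :=
  PowerSeries.mk fun m => PowerSeries.mk fun k =>
    if 0 < m + k then
      (((m + k : ℕ) : ℂ)⁻¹ * binomial ((m + k : ℕ) : ℂ) c k) •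
        creationVar j (m + k)
    else 0

theorem creationMap_creationSum (j : Fin 2) (c : ℂ) :
    creationMap (creationSum j c) = negSum j c := by
  ext1 m
  ext1 k
  simp only [creationMap, creationSum, negSum, coeff_map, coeff_mk]
  split_ifs with h
  · rw [RingHom.coe_coe, map_smul, creationHom_creationVar, a, if_pos (by omega), Int.natAbs_neg,
      Int.natAbs_natCast]
  · simp

/-- The exponent of `E⁻(u)`. -/
def creationExponent : PowerSeries (PowerSeries CreationRing) :=
  -creationSum 0 (-3 / 4) + creationSum 1 (1 / 4)

theorem coeff_zero_creationExponent : coeff 0 (coeff 0 creationExponent) = 0 := by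
  simp only [creationExponent, map_add, map_neg, creationSum, coeff_mk]
  simp

theorem EMinusSeries_eq : EMinusSeries = creationMap (formalExp creationExponent) := by
  have h := formalExp_map (B := Module.End ℂ V) creationHom creationExponent
  have h2 : creationMap creationExponent = -negSum 0 (-3 / 4) + negSum 1 (1 / 4) := by
    rw [← creationMap_creationSum, ← creationMap_creationSum, ← map_neg, ← map_add]
    rfl
  rw [EMinusSeries, ← h2]
  exact h

theorem isUnit_coeff_zero_formalExp : IsUnit (coeff 0 (formalExp creationExponent)) := by
  rw [isUnit_iff_constantCoeff]
  simp [formalExp]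

/-- `E⁻(0)⁻¹ E⁻(u)` with coefficients in the algebra of creation operators. -/
def creationSeries : PowerSeries (PowerSeries CreationRing) :=
  C (Ring.inverse (coeff 0 (formalExp creationExponent))) * formalExp creationExponent

theorem coeff_zero_creationSeries : coeff 0 creationSeries = 1 := by
  rw [creationSeries, coeff_C_mul, Ring.inverse_mul_cancel _ isUnit_coeff_zero_formalExp]

theorem derivative_creationSeries : d⁄dX (PowerSeries CreationRing) creationSeries =
    d⁄dX (PowerSeries CreationRing) creationExponent * creationSeries := by
  rw [creationSeries, derivative_mul, derivative_C,
    derivative_formalExp coeff_zero_creationExponent]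
  ring

/-- `E⁻(0)⁻¹ E⁻(u)` as a series in `u` and `h`. -/
def EMinusNormalized : PowerSeries (PowerSeries (Module.End ℂ V)) := creationMap creationSeries

theorem EMinusZeroInv_mul_EMinus :
    (fun n => EMinusZeroInv * EMinus n) = ofU EMinusNormalized := by
  have h : Ring.inverse (coeff 0 EMinusSeries) =
      PowerSeries.map (creationHom : CreationRing →+* Module.End ℂ V)
        (Ring.inverse (coeff 0 (formalExp creationExponent))) := by
    obtain ⟨x, hx⟩ := isUnit_coeff_zero_formalExp
    rw [EMinusSeries_eq, creationMap, coeff_map, ← hx, Ring.inverse_unit]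
    exact Ring.inverse_unit (Units.map (RingHom.toMonoidHom
      (PowerSeries.map (creationHom : CreationRing →+* Module.End ℂ V))) x)
  funext n
  simp only [EMinusZeroInv, EMinus, ofU]
  split_ifs
  · rw [← toEnd_mul, h, EMinusSeries_eq, EMinusNormalized, creationSeries, map_mul, creationMap,
      map_C, coeff_C_mul]
  · simp

theorem coeff_derivative_creationSum (j : Fin 2) (c : ℂ) (i k : ℕ) :
    coeff k (coeff i (d⁄dX (PowerSeries CreationRing) (creationSum j c))) =
      (((i + k).choose k : ℂ) * c ^ k) •
        creationVar j (i + k + 1) := by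
  have h2 : coeff k (coeff i (d⁄dX (PowerSeries CreationRing) (creationSum j c))) =
      (i + 1) • coeff k (coeff (i + 1) (creationSum j c)) := by
    rw [coeff_derivative, ← map_nsmul, nsmul_eq_mul, mul_comm, Nat.cast_succ]
  rw [h2, creationSum, coeff_mk, coeff_mk, if_pos (by omega), ← Nat.cast_smul_eq_nsmul ℂ,
    smul_smul, show i + 1 + k = i + k + 1 by ring, binomial, Ring.choose_natCast]
  congr 1
  have h3 : ((i + k + 1 : ℕ) : ℂ) ≠ 0 := Nat.cast_ne_zero.2 (Nat.succ_ne_zero _)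
  have h4 : ((i + k + 1 : ℕ) : ℂ) * ((i + k).choose k : ℕ) =
      ((i + k + 1).choose k : ℕ) * ((i + 1 : ℕ) : ℂ) := by
    have := Nat.add_one_mul_choose_eq (i + k) i
    rw [Nat.choose_symm_add, ← Nat.choose_symm (show i + 1 ≤ i + k + 1 by omega),
      show i + k + 1 - (i + 1) = k by omega] at this
    exact_mod_cast this
  field_simp
  linear_combination c ^ k * (-h4)

/-! ### Commutators -/

/-- The Heisenberg relation `[a_j(r), a_l(-s)] = r δ_{jl} δ_{rs}` for `r, s > 0`. -/
theorem a_mul_creation (j l : Fin 2) (r s : ℕ) (hr : 0 < r) (hs : 0 < s) :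
    a j r * creationHom (creationVar l s) =
      creationHom (creationVar l s) * a j r +
        (if j = l ∧ r = s then (r : ℂ) else 0) • 1 := by
  refine endV_ext fun κ f => ?_
  simp only [a, if_neg (show ¬ ((r : ℤ) < 0) by omega), Int.natAbs_natCast, creationHom_creationVar,
    Module.End.mul_apply, LinearMap.add_apply, onCreation_single, LinearMap.mulLeft_apply,
    LinearMap.smul_apply, Module.End.one_apply, Derivation.coeFn_coe, Derivation.leibniz,
    MvPolynomial.pderiv_X, smul_eq_mul, Int.cast_natCast]
  have hX : (if j = l ∧ r = s then (r : ℂ) else 0) • f =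
      (r : ℂ) • (f * Pi.single (M := fun _ => CreationAlg) (j, r.toPNat') 1 (l, s.toPNat')) := by
    have hrs : ((l, s.toPNat') : Fin 2 × ℕ+) = (j, r.toPNat') ↔ j = l ∧ r = s := by
      rw [Prod.mk.injEq, eq_comm, ← PNat.coe_inj, Nat.toPNat'_coe, Nat.toPNat'_coe, if_pos hr,
        if_pos hs, eq_comm (a := s)]
    simp only [Pi.single_apply, hrs]
    split_ifs <;> simp
  rw [AddMonoidAlgebra.smul_single, hX, ← AddMonoidAlgebra.single_add, smul_add, mul_smul_comm]

/-- `∑_k binomial(i + k, k) (d h)ᵏ w^{i + k + 1}`, the coefficient of `vⁱ` in the expansion of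
`w / (1 - d h w - v w)`; for `w = u⁻¹` this is `1 / (u - v - d h)`. -/
def kernelCoeff (d : ℂ) (i : ℕ) : PowerSeries (PowerSeries ℂ) :=
  PowerSeries.mk fun m => PowerSeries.mk fun k =>
    if m = i + k + 1 then ((i + k).choose k : ℂ) * d ^ k else 0

/-- Scalar series as operator series. -/
abbrev scalarMap (A : Type) [Ring A] [Algebra ℂ A] :
    PowerSeries (PowerSeries ℂ) →+* PowerSeries (PowerSeries A) :=
  PowerSeries.map (PowerSeries.map (algebraMap ℂ A))

theorem scalarMap_commute {A : Type} [Ring A] [Algebra ℂ A] (c : PowerSeries (PowerSeries ℂ))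
    (F : PowerSeries (PowerSeries A)) : Commute (scalarMap A c) F := by
  refine commute_of_coeff fun m n => commute_of_coeff fun k l => ?_
  rw [coeff_map, coeff_map]
  exact Algebra.commutes _ _

/-- The terms in `h^K` of `∑_q binomial(i + q, q) (c' h)^q (u + c h)^{-(i + q + 1)}`, the
coefficient of `vⁱ` in `1 / ((u + c h) - (v + c' h))`, depend on `c' - c` only. -/
theorem sum_choose_neg (i K : ℕ) (c c' : ℂ) :
    ∑ q ∈ Finset.HasAntidiagonal.antidiagonal K,
      binomial (-((i + q.2 + 1 : ℕ) : ℂ)) c q.1 * (((i + q.2).choose q.2 : ℂ) * c' ^ q.2) =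
    ((i + K).choose K : ℂ) * (c' - c) ^ K := by
  rw [show c' - c = -c + c' by ring, (Commute.all (-c) c').add_pow', Finset.mul_sum]
  refine Finset.sum_congr rfl fun q hq => ?_
  rw [Finset.HasAntidiagonal.mem_antidiagonal] at hq
  have h1 : Ring.choose (-((i + q.2 + 1 : ℕ) : ℂ)) q.1 = (-1) ^ q.1 * ((i + K).choose q.1 : ℂ) := by
    rw [Ring.choose_neg, show ((i + q.2 + 1 : ℕ) : ℂ) + q.1 - 1 = ((i + K : ℕ) : ℂ) by
      rw [← hq]; push_cast; ring, Ring.choose_natCast, Int.negOnePow_def, Units.smul_def]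
    simp
  have h2 : ((i + K).choose K : ℂ) * (K.choose q.1 : ℂ) =
      ((i + K).choose q.1 : ℂ) * ((i + q.2).choose q.2 : ℂ) := by
    have := Nat.choose_mul (n := i + K) (k := K) (s := q.1) (by omega)
    rw [show i + K - q.1 = i + q.2 by omega, show K - q.1 = q.2 by omega] at this
    exact_mod_cast this
  rw [binomial, h1, nsmul_eq_mul, neg_pow c]
  linear_combination (-(-1) ^ q.1 * c ^ q.1 * c' ^ q.2) * h2

/-- The commutator `[∑_r (a_j(r) / r) (u + c h)⁻ʳ, ∑_s a_l(-s) (v + c' h)^{s - 1}]`, taken at the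
coefficient of `vⁱ`, with `w = u⁻¹`, for elements `a_j(r) = y r` and `a_l(-s) = x s` of any
algebra. -/
theorem commutator_kernelCoeff {A : Type} [Ring A] [Algebra ℂ A] {x y : ℕ → A} {δ : ℂ}
    (hxy : ∀ r s, 0 < r → 0 < s → y r * x s = x s * y r + (if r = s then δ * r else 0) • 1)
    (c c' : ℂ) (i : ℕ) {F : PowerSeries (PowerSeries A)} {G : PowerSeries A}
    (hF : ∀ m k, coeff k (coeff m F) = if k < m then
      (((m - k : ℕ) : ℂ)⁻¹ * binomial (-((m - k : ℕ) : ℂ)) c k) • y (m - k) else 0)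
    (hG : ∀ k, coeff k G = (((i + k).choose k : ℂ) * c' ^ k) • x (i + k + 1)) :
    F * C G = C G * F + δ • scalarMap A (kernelCoeff (c' - c) i) := by
  ext m K
  rw [coeff_mul_C, map_add, map_add, coeff_C_mul, coeff_mul, coeff_mul,
    ← Finset.Nat.sum_antidiagonal_swap (n := K)
      (f := fun p => coeff p.1 G * coeff p.2 (coeff m F)), ← sub_eq_iff_eq_add',
    ← Finset.sum_sub_distrib]
  have h : ∀ q ∈ Finset.HasAntidiagonal.antidiagonal K,
      coeff q.1 (coeff m F) * coeff q.2 G - coeff q.swap.1 G * coeff q.swap.2 (coeff m F) =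
      (if m = i + K + 1 then δ * (binomial (-((i + q.2 + 1 : ℕ) : ℂ)) c q.1 *
        (((i + q.2).choose q.2 : ℂ) * c' ^ q.2)) else 0) • (1 : A) := by
    intro q hq
    rw [Finset.HasAntidiagonal.mem_antidiagonal] at hq
    rw [Prod.fst_swap, Prod.snd_swap, hF, hG]
    split_ifs with h1 h2 h2
    · rw [smul_mul_smul_comm, smul_mul_smul_comm, hxy _ _ (by omega) (by omega),
        if_pos (by omega), show m - q.1 = i + q.2 + 1 by omega]
      have h3 : ((i + q.2 + 1 : ℕ) : ℂ) ≠ 0 := Nat.cast_ne_zero.2 (Nat.succ_ne_zero _)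
      rw [mul_comm (((i + q.2).choose q.2 : ℂ) * c' ^ q.2), smul_add, add_sub_cancel_left,
        smul_smul]
      congr 1
      field_simp
    · rw [smul_mul_smul_comm, smul_mul_smul_comm, hxy _ _ (by omega) (by omega),
        if_neg (by omega), zero_smul, add_zero,
        mul_comm (((i + q.2).choose q.2 : ℂ) * c' ^ q.2), sub_self]
    · omega
    · simp
  rw [Finset.sum_congr rfl h, ← Finset.sum_smul]
  have h4 : coeff K (coeff m (δ • scalarMap A (kernelCoeff (c' - c) i))) =
      δ • coeff K (coeff m (scalarMap A (kernelCoeff (c' - c) i))) := rfl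
  rw [h4, coeff_map, coeff_map, kernelCoeff, coeff_mk, coeff_mk,
    Algebra.algebraMap_eq_smul_one, smul_smul]
  congr 1
  by_cases hm : m = i + K + 1
  · simp only [hm, if_true]
    rw [← Finset.mul_sum, sum_choose_neg i K c c']
  · simp [hm]

theorem posSum_mul_creationSum (j l : Fin 2) (c c' : ℂ) (i : ℕ) :
    posSum j c * C (PowerSeries.map (creationHom : CreationRing →+* Module.End ℂ V)
        (coeff i (d⁄dX (PowerSeries CreationRing) (creationSum l c')))) =
      C (PowerSeries.map (creationHom : CreationRing →+* Module.End ℂ V)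
        (coeff i (d⁄dX (PowerSeries CreationRing) (creationSum l c')))) * posSum j c +
      (if j = l then 1 else 0 : ℂ) • scalarMap (Module.End ℂ V) (kernelCoeff (c' - c) i) := by
  have h := commutator_kernelCoeff (A := Module.End ℂ V)
    (x := fun s => creationHom (creationVar l s)) (y := fun r => a j r)
    (δ := if j = l then 1 else 0) (fun r s hr hs => ?_) c c' i (F := posSum j c)
    (G := PowerSeries.map (creationHom : CreationRing →+* Module.End ℂ V)
        (coeff i (d⁄dX (PowerSeries CreationRing) (creationSum l c')))) (fun m k => ?_)
    (fun k => ?_)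
  · exact h
  · rw [a_mul_creation j l r s hr hs]
    congr 2
    split_ifs <;> simp_all
  · simp only [posSum, coeff_mk]
  · rw [coeff_map, coeff_derivative_creationSum, RingHom.coe_coe, map_smul]

/-! ### The exchange relation -/

/-- `1 - d h w`. -/
def kernelConst (d : ℂ) : PowerSeries (PowerSeries ℂ) := 1 - X * C (C d * X)

/-- The geometric series `∑ᵢ kernelCoeff d i vⁱ` is `w / (1 - d h w - v w)`. -/
theorem mul_mk_kernelCoeff (d : ℂ) :
    (C (kernelConst d) - C X * X) * PowerSeries.mk (kernelCoeff d) = C X := by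
  ext j m k
  rw [sub_mul, map_sub, coeff_C_mul, mul_assoc, coeff_C_mul, coeff_mk, kernelConst, sub_mul,
    one_mul, mul_assoc, coeff_C]
  have h1 : coeff k (coeff m (X * (C (C d * X) * kernelCoeff d j))) =
      if m = j + k + 1 then d ^ k * ((j + k - 1).choose (k - 1) : ℂ) * (if k = 0 then 0 else 1)
        else 0 := by
    cases m with
    | zero => simp
    | succ m =>
      rw [coeff_succ_X_mul, coeff_C_mul, mul_assoc, coeff_C_mul]
      cases k with
      | zero => simp
      | succ k =>
        rw [coeff_succ_X_mul, kernelCoeff, coeff_mk, coeff_mk]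
        by_cases hm : m = j + k + 1
        · rw [if_pos hm, if_pos (by omega), if_neg (by omega),
            show j + (k + 1) - 1 = j + k by omega, Nat.add_sub_cancel]
          ring
        · rw [if_neg hm, if_neg (by omega), mul_zero]
  have h2 : coeff k (coeff m (X * coeff j (X * PowerSeries.mk (kernelCoeff d)))) =
      if m = j + k + 1 then d ^ k * ((j + k - 1).choose k : ℂ) * (if j = 0 then 0 else 1)
        else 0 := by
    cases j with
    | zero => simp
    | succ j =>
      rw [coeff_succ_X_mul, coeff_mk]
      cases m with
      | zero => simp
      | succ m =>
        rw [coeff_succ_X_mul, kernelCoeff, coeff_mk, coeff_mk]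
        by_cases hm : m = j + k + 1
        · rw [if_pos hm, if_pos (by omega), if_neg (by omega),
            show j + 1 + k - 1 = j + k by omega]
          ring
        · rw [if_neg hm, if_neg (by omega)]
  simp only [map_sub, h1, h2]
  rw [kernelCoeff, coeff_mk, coeff_mk]
  by_cases hm : m = j + k + 1
  · rw [if_pos hm, if_pos hm, if_pos hm]
    rcases j with _ | j
    · rcases k with _ | k
      · simp [hm]
      · have : m ≠ 1 := by omega
        simp [coeff_X, this]
    · rcases k with _ | k
      · simp
      · rw [show j + 1 + (k + 1) = (j + k + 1) + 1 by ring, Nat.choose_succ_succ (j + k + 1) k]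
        simp only [Nat.add_sub_cancel, Nat.succ_eq_add_one, Nat.cast_add]
        simp
        ring
  · rw [if_neg hm, if_neg hm, if_neg hm]
    by_cases hj : j = 0
    · subst hj
      rw [if_pos rfl, coeff_X]
      by_cases h1 : m = 1
      · have hk : k ≠ 0 := by omega
        rw [if_pos h1, coeff_one, if_neg hk]
        simp
      · simp [h1]
    · simp [hj]

/-- The logarithmic derivative of a product of two linear factors. -/
theorem derivative_quadratic {R : Type} [CommRing R] {a b w : R} {κ κ' : PowerSeries R}
    (h : (C a - C w * X) * κ = C w) (h' : (C b - C w * X) * κ' = C w) :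
    d⁄dX R ((C a - C w * X) * (C b - C w * X)) =
      (-κ - κ') * ((C a - C w * X) * (C b - C w * X)) := by
  have hd : ∀ c : R, d⁄dX R (C c - C w * X) = -C w := fun c => by
    rw [map_sub, derivative_mul, derivative_C, derivative_C, derivative_X]
    ring
  rw [derivative_mul, hd, hd]
  linear_combination (C b - C w * X) * h + (C a - C w * X) * h'

theorem coeff_quadratic_mul {R : Type} [CommRing R] (a b w : R) (F : PowerSeries R) (j : ℕ) :
    coeff j ((C a - C w * X) * (C b - C w * X) * F) =
      a * b * coeff j F - (a + b) * w * (if 1 ≤ j then coeff (j - 1) F else 0) +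
        w ^ 2 * (if 2 ≤ j then coeff (j - 2) F else 0) := by
  have h : (C a - C w * X) * (C b - C w * X) * F =
      C (a * b) * F - C ((a + b) * w) * (X ^ 1 * F) + C (w ^ 2) * (X ^ 2 * F) := by
    simp only [map_mul, map_add, map_pow]
    ring
  rw [h, map_add, map_sub, coeff_C_mul, coeff_C_mul, coeff_C_mul, coeff_X_pow_mul',
    coeff_X_pow_mul']

/-- Let `M` solve `M' = N M`, `M(0) = 1`, and let `P` solve `P' = (N + c) P`. If `Φ` intertwines
`N` and `N + c`, then `P(0) Φ M = P Φ`, as both sides solve the same differential equation. -/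
theorem intertwine_of_recursion {R : Type} [Ring R]
    (hR : ∀ (n : ℕ) (x y : R), (n + 1) • x = (n + 1) • y → x = y) {Φ : R}
    {M N P c : ℕ → R} (hN : ∀ i, Φ * N i = (N i + c i) * Φ) (hP0 : ∀ x, Commute (P 0) x)
    (hM : ∀ j, (j + 1) • M (j + 1) =
      ∑ p ∈ Finset.HasAntidiagonal.antidiagonal j, N p.1 * M p.2) (hM0 : M 0 = 1)
    (hP : ∀ j, (j + 1) • P (j + 1) =
      ∑ p ∈ Finset.HasAntidiagonal.antidiagonal j, (N p.1 + c p.1) * P p.2) (j : ℕ) :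
    P 0 * Φ * M j = P j * Φ := by
  refine eq_of_recursion hR (a := fun i => N i + c i) (Y := fun j => P 0 * Φ * M j)
    (Z := fun j => P j * Φ) (fun j => ?_) (fun j => ?_) (by simp [hM0]) j
  · rw [← mul_smul_comm, hM, Finset.mul_sum]
    refine Finset.sum_congr rfl fun p _ => ?_
    rw [← mul_assoc, mul_assoc (P 0), hN, ← mul_assoc, (hP0 _).eq]
    simp only [mul_assoc]
  · rw [← smul_mul_assoc, hP, Finset.sum_mul]
    exact Finset.sum_congr rfl fun p _ => mul_assoc _ _ _

/-- The coefficients in `v` of the derivative of the exponent of `E⁻(v)`. -/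
def exponentDeriv (i : ℕ) : PowerSeries (Module.End ℂ V) :=
  PowerSeries.map (creationHom : CreationRing →+* Module.End ℂ V)
    (coeff i (d⁄dX (PowerSeries CreationRing) creationExponent))

theorem commutator_sub {R : Type} [Ring R] {P Q G H s t : R} (h1 : P * G = G * P + s)
    (h2 : P * H = H * P) (h3 : Q * G = G * Q) (h4 : Q * H = H * Q + t) :
    (P - Q) * (-G + H) = (-G + H) * (P - Q) + (-s + -t) := by
  simp only [sub_mul, mul_sub, add_mul, mul_add, neg_mul, mul_neg, h1, h2, h3, h4]
  abel

theorem commutator_add {R : Type} [Ring R] {P Q G H s t : R} (h1 : P * G = G * P + s)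
    (h2 : P * H = H * P) (h3 : Q * G = G * Q) (h4 : Q * H = H * Q + t) :
    (P + Q) * (-G + H) = (-G + H) * (P + Q) + (-s + t) := by
  simp only [add_mul, mul_add, neg_mul, mul_neg, h1, h2, h3, h4]
  abel

theorem derivative_neg_add {R : Type} [CommRing R] (F G : PowerSeries R) :
    d⁄dX R (-F + G) = -d⁄dX R F + d⁄dX R G := by
  rw [map_add, map_neg]

theorem C_exponentDeriv (i : ℕ) : C (exponentDeriv i) =
    -C (PowerSeries.map (creationHom : CreationRing →+* Module.End ℂ V)
        (coeff i (d⁄dX (PowerSeries CreationRing) (creationSum 0 (-3 / 4))))) +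
      C (PowerSeries.map (creationHom : CreationRing →+* Module.End ℂ V)
        (coeff i (d⁄dX (PowerSeries CreationRing) (creationSum 1 (1 / 4))))) := by
  rw [exponentDeriv, creationExponent, derivative_neg_add, map_add, map_neg, map_add, map_neg,
    map_add, map_neg]

theorem coeff_zero_posSum (j : Fin 2) (c : ℂ) : coeff 0 (coeff 0 (posSum j c)) = 0 := by
  simp [posSum]

theorem coeff_zero_sub {A : Type} [Ring A] {F G : PowerSeries (PowerSeries A)}
    (hF : coeff 0 (coeff 0 F) = 0) (hG : coeff 0 (coeff 0 G) = 0) :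
    coeff 0 (coeff 0 (F - G)) = 0 := by
  rw [map_sub, map_sub, hF, hG, sub_zero]

theorem coeff_zero_add {A : Type} [Ring A] {F G : PowerSeries (PowerSeries A)}
    (hF : coeff 0 (coeff 0 F) = 0) (hG : coeff 0 (coeff 0 G) = 0) :
    coeff 0 (coeff 0 (F + G)) = 0 := by
  rw [map_add, map_add, hF, hG, add_zero]

theorem EPlusSeries_mul (i : ℕ) : EPlusSeries * C (exponentDeriv i) =
    (C (exponentDeriv i) + scalarMap (Module.End ℂ V) (-kernelCoeff (-1) i + -kernelCoeff 0 i)) *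
      EPlusSeries := by
  have h1 := posSum_mul_creationSum 0 0 (1 / 4) (-3 / 4) i
  have h2 := posSum_mul_creationSum 0 1 (1 / 4) (1 / 4) i
  have h3 := posSum_mul_creationSum 1 0 (1 / 4) (-3 / 4) i
  have h4 := posSum_mul_creationSum 1 1 (1 / 4) (1 / 4) i
  rw [if_pos rfl, one_smul] at h1 h4
  rw [if_neg (by decide), zero_smul, add_zero] at h2 h3
  have h := commutator_sub (R := PowerSeries (PowerSeries (Module.End ℂ V))) h1 h2 h3 h4
  rw [← C_exponentDeriv, ← map_neg, ← map_neg, ← map_add,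
    show (-3 / 4 - 1 / 4 : ℂ) = -1 by norm_num, sub_self] at h
  have h5 := formalExp_mul_of_commutator (A := Module.End ℂ V) ?_ h (scalarMap_commute _ _)
  · exact h5
  · exact coeff_zero_sub (coeff_zero_posSum _ _) (coeff_zero_posSum _ _)

theorem EBarPlusSeries_mul (i : ℕ) : EBarPlusSeries * C (exponentDeriv i) =
    (C (exponentDeriv i) + scalarMap (Module.End ℂ V) (-kernelCoeff 1 i + kernelCoeff 0 i)) *
      EBarPlusSeries := by
  have h1 := posSum_mul_creationSum 0 0 (-7 / 4) (-3 / 4) i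
  have h2 := posSum_mul_creationSum 0 1 (-7 / 4) (1 / 4) i
  have h3 := posSum_mul_creationSum 1 0 (1 / 4) (-3 / 4) i
  have h4 := posSum_mul_creationSum 1 1 (1 / 4) (1 / 4) i
  rw [if_pos rfl, one_smul] at h1 h4
  rw [if_neg (by decide), zero_smul, add_zero] at h2 h3
  have h := commutator_add (R := PowerSeries (PowerSeries (Module.End ℂ V))) h1 h2 h3 h4
  rw [← C_exponentDeriv, ← map_neg, ← map_add, show (-3 / 4 - -7 / 4 : ℂ) = 1 by norm_num,
    sub_self] at h
  have h5 := formalExp_mul_of_commutator (A := Module.End ℂ V) ?_ h (scalarMap_commute _ _)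
  · exact h5
  · exact coeff_zero_add (coeff_zero_posSum _ _) (coeff_zero_posSum _ _)

/-- `E⁺(u) Ē⁺(u)` as a series in `w = u⁻¹` and `h`. -/
def annihilationSeries : PowerSeries (PowerSeries (Module.End ℂ V)) :=
  EPlusSeries * EBarPlusSeries

theorem intertwine_mul {R : Type} [Ring R] {Φ Ψ N s t : R} (h1 : Φ * N = (N + s) * Φ)
    (h2 : Ψ * N = (N + t) * Ψ) (ht : ∀ x, Commute t x) :
    Φ * Ψ * N = (N + (s + t)) * (Φ * Ψ) := by
  rw [mul_assoc, h2, ← mul_assoc, mul_add, h1, ← (ht Φ).eq, ← add_mul, mul_assoc, add_assoc]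

theorem annihilationSeries_mul (i : ℕ) : annihilationSeries * C (exponentDeriv i) =
    (C (exponentDeriv i) + scalarMap (Module.End ℂ V) (-kernelCoeff 1 i - kernelCoeff (-1) i)) *
      annihilationSeries := by
  have h := intertwine_mul (R := PowerSeries (PowerSeries (Module.End ℂ V)))
    (EPlusSeries_mul i) (EBarPlusSeries_mul i)
    (fun x => scalarMap_commute _ x)
  rw [← map_add, show -kernelCoeff (-1) i + -kernelCoeff 0 i +
    (-kernelCoeff 1 i + kernelCoeff 0 i) = -kernelCoeff 1 i - kernelCoeff (-1) i by ring] at h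
  exact h

/-- `(1 - h w - v w) (1 + h w - v w) = ((u - v)² - h²) / u²` for `w = u⁻¹`, the outer variable
being `v`. -/
def exchangeFactor : PowerSeries (PowerSeries (PowerSeries ℂ)) :=
  (C (kernelConst 1) - C X * X) * (C (kernelConst (-1)) - C X * X)

theorem derivative_exchangeFactor : d⁄dX (PowerSeries (PowerSeries ℂ)) exchangeFactor =
    (-PowerSeries.mk (kernelCoeff 1) - PowerSeries.mk (kernelCoeff (-1))) * exchangeFactor :=
  derivative_quadratic (mul_mk_kernelCoeff 1) (mul_mk_kernelCoeff (-1))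

theorem kernelConst_add : kernelConst 1 + kernelConst (-1) = 2 := by
  simp only [kernelConst, map_mul, map_neg, map_one]
  ring

theorem kernelConst_mul : kernelConst 1 * kernelConst (-1) = 1 - X ^ 2 * C (X ^ 2) := by
  simp only [kernelConst, map_mul, map_neg, map_one, map_pow]
  ring

theorem derivative_mul_map {R S T : Type} [CommRing R] [CommRing S] [CommRing T] (φ : R →+* T)
    (ψ : S →+* T) {Q c : PowerSeries R} {M N : PowerSeries S} (hQ : d⁄dX R Q = c * Q)
    (hM : d⁄dX S M = N * M) :
    d⁄dX T (map φ Q * map ψ M) = (map ψ N + map φ c) * (map φ Q * map ψ M) := by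
  rw [derivative_mul, derivative_map, derivative_map, hQ, hM, map_mul, map_mul]
  ring

/-- The solution `((u - v)² - h²) u⁻² E⁻(0)⁻¹ E⁻(v)` of the exchanged differential equation. -/
def exchangeSeries : PowerSeries (PowerSeries (PowerSeries CreationRing)) :=
  map (scalarMap CreationRing) exchangeFactor * map C creationSeries

theorem creationMap_scalarMap (c : PowerSeries (PowerSeries ℂ)) :
    creationMap (scalarMap CreationRing c) = scalarMap (Module.End ℂ V) c := by
  ext1 m
  ext1 k
  simp only [creationMap, scalarMap, coeff_map]
  exact creationHom.commutes _

theorem scalarMap_X (A : Type) [Ring A] [Algebra ℂ A] : scalarMap A X = X := map_X _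

theorem scalarMap_C_X (A : Type) [Ring A] [Algebra ℂ A] : scalarMap A (C X) = C X := by
  rw [scalarMap, map_C, map_X]

/-- The coefficient of `vʲ` in `E⁻(0)⁻¹ E⁻(v)`. -/
def creationCoeff (j : ℤ) : PowerSeries (Module.End ℂ V) :=
  if 0 ≤ j then coeff j.toNat EMinusNormalized else 0

theorem creationCoeff_natCast (j : ℕ) : creationCoeff j =
    map (creationHom : CreationRing →+* Module.End ℂ V) (coeff j creationSeries) := by
  rw [creationCoeff, if_pos (by omega), Int.toNat_natCast, EMinusNormalized, creationMap, coeff_map]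

theorem creationCoeff_sub (j l : ℕ) : creationCoeff ((j : ℤ) - l) =
    map (creationHom : CreationRing →+* Module.End ℂ V)
      (if l ≤ j then coeff (j - l) creationSeries else 0) := by
  split_ifs with h
  · rw [← creationCoeff_natCast, Nat.cast_sub h]
  · rw [creationCoeff, if_neg (by omega), map_zero]

theorem creationMap_C (x : PowerSeries CreationRing) : creationMap (C x) =
    C (map (creationHom : CreationRing →+* Module.End ℂ V) x) := map_C _ _

theorem coeff_exchangeSeries (j : ℕ) : coeff j exchangeSeries =
    scalarMap CreationRing (1 - X ^ 2 * C (X ^ 2)) * C (coeff j creationSeries) -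
      scalarMap CreationRing (2 * X) *
        C (if 1 ≤ j then coeff (j - 1) creationSeries else 0) +
      scalarMap CreationRing (X ^ 2) *
        C (if 2 ≤ j then coeff (j - 2) creationSeries else 0) := by
  have h : map (scalarMap CreationRing) exchangeFactor =
      (C (scalarMap CreationRing (kernelConst 1)) - C (scalarMap CreationRing X) * X) *
        (C (scalarMap CreationRing (kernelConst (-1))) - C (scalarMap CreationRing X) * X) := by
    simp only [exchangeFactor, map_mul, map_sub, map_C, map_X]
  rw [exchangeSeries, h, coeff_quadratic_mul, ← map_mul, kernelConst_mul, ← map_add,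
    kernelConst_add, ← map_mul, ← map_pow]
  simp only [coeff_map]
  split_ifs <;> simp

theorem creationMap_coeff_add (i : ℕ) :
    creationMap (coeff i (map C (d⁄dX (PowerSeries CreationRing) creationExponent) +
      map (scalarMap CreationRing)
        (-PowerSeries.mk (kernelCoeff 1) - PowerSeries.mk (kernelCoeff (-1))))) =
    C (exponentDeriv i) +
      scalarMap (Module.End ℂ V) (-kernelCoeff 1 i - kernelCoeff (-1) i) := by
  rw [map_add, map_add, coeff_map, coeff_map, creationMap_scalarMap, creationMap_C, map_sub,
    map_neg, coeff_mk, coeff_mk]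
  rfl

/-- Exchanging `E⁺(u) Ē⁺(u)` with `E⁻(0)⁻¹ E⁻(v)` produces the factor
`((u - v)² - h²) / (u² - h²)`. -/
theorem annihilation_exchange (j : ℕ) :
    scalarMap (Module.End ℂ V) (1 - X ^ 2 * C (X ^ 2)) * annihilationSeries *
        C (creationCoeff j) =
      (scalarMap (Module.End ℂ V) (1 - X ^ 2 * C (X ^ 2)) * C (creationCoeff j) -
        scalarMap (Module.End ℂ V) (2 * X) * C (creationCoeff (j - 1)) +
        scalarMap (Module.End ℂ V) (X ^ 2) * C (creationCoeff (j - 2))) * annihilationSeries := by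
  have hP : ∀ j : ℕ, creationMap (coeff j exchangeSeries) =
      scalarMap (Module.End ℂ V) (1 - X ^ 2 * C (X ^ 2)) * C (creationCoeff j) -
        scalarMap (Module.End ℂ V) (2 * X) * C (creationCoeff (j - 1)) +
        scalarMap (Module.End ℂ V) (X ^ 2) * C (creationCoeff (j - 2)) := fun j => by
    have h1 := creationCoeff_sub j 1
    have h2 := creationCoeff_sub j 2
    rw [Nat.cast_one] at h1
    rw [Nat.cast_two] at h2
    rw [coeff_exchangeSeries, map_add, map_sub, map_mul creationMap, map_mul creationMap,
      map_mul creationMap, creationMap_scalarMap,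
      creationMap_scalarMap, creationMap_scalarMap, creationMap_C, creationMap_C, creationMap_C,
      ← h1, ← h2, creationCoeff_natCast]
  have hM0 : creationCoeff ((0 : ℕ) : ℤ) = 1 := by
    rw [creationCoeff_natCast, coeff_zero_creationSeries, map_one]
  have hP0 : creationMap (coeff 0 exchangeSeries) =
      scalarMap (Module.End ℂ V) (1 - X ^ 2 * C (X ^ 2)) := by
    rw [hP, hM0, creationCoeff, creationCoeff]
    simp
  have h := intertwine_of_recursion (R := PowerSeries (PowerSeries (Module.End ℂ V)))
    nsmul_series_injective
    (Φ := annihilationSeries) (M := fun j => C (creationCoeff j))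
    (N := fun i => C (exponentDeriv i)) (P := fun j => creationMap (coeff j exchangeSeries))
    (c := fun i => scalarMap (Module.End ℂ V) (-kernelCoeff 1 i - kernelCoeff (-1) i))
    annihilationSeries_mul ?_ ?_ ?_ ?_ j
  · rw [← hP, ← hP0]
    exact h
  · intro x
    simp only [hP0]
    exact scalarMap_commute _ _
  · intro j
    have h1 := congrArg ((C : PowerSeries (Module.End ℂ V) →+* _).comp
      (map (creationHom : CreationRing →+* Module.End ℂ V)))
      (recursion_of_derivative derivative_creationSeries j)
    simp only [map_nsmul, map_sum, map_mul, RingHom.comp_apply, ← creationCoeff_natCast] at h1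
    exact h1
  · simp only [hM0, map_one]
  · intro j
    have h1 := congrArg creationMap (recursion_of_derivative
      (derivative_mul_map (scalarMap CreationRing) C derivative_exchangeFactor
        derivative_creationSeries) j)
    rw [map_nsmul, map_sum] at h1
    refine h1.trans (Finset.sum_congr rfl fun p _ => ?_)
    rw [map_mul creationMap, creationMap_coeff_add]
    rfl

/-- Comparison of coefficients in the exchange relation, where `y` stands for `h²`, the variable
is `u⁻¹`, and `a`, `b`, `c` are three successive coefficients of `E⁻(0)⁻¹ E⁻(v)`. -/
theorem coeff_exchange_aux {A : Type} [Ring A] {F : PowerSeries A} {y a b c : A}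
    (h : (1 - X ^ 2 * C y) * F * C a =
      ((1 - X ^ 2 * C y) * C a - 2 * X * C b + X ^ 2 * C c) * F) (m : ℕ) :
    coeff m F * a - y * (if 2 ≤ m then coeff (m - 2) F else 0) * a =
      a * coeff m F - y * a * (if 2 ≤ m then coeff (m - 2) F else 0) -
        2 * b * (if 1 ≤ m then coeff (m - 1) F else 0) +
        c * (if 2 ≤ m then coeff (m - 2) F else 0) := by
  have h1 := congrArg (coeff m) h
  have h2 : (1 - X ^ 2 * C y) * F * C a = F * C a - X ^ 2 * (C y * F * C a) := by
    simp only [sub_mul, one_mul, mul_assoc]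
  have h3 : ((1 - X ^ 2 * C y) * C a - 2 * X * C b + X ^ 2 * C c) * F =
      C a * F - X ^ 2 * (C (y * a) * F) - X ^ 1 * (C (2 * b) * F) + X ^ 2 * (C c * F) := by
    rw [show (C (2 * b) : PowerSeries A) = 2 * C b by rw [map_mul, map_ofNat], map_mul,
      show (2 * X : PowerSeries A) = X * 2 from (Commute.ofNat_left 2 X).eq]
    simp only [sub_mul, add_mul, one_mul, mul_assoc, pow_one]
  rw [h2, h3] at h1
  simp only [map_sub, map_add, coeff_X_pow_mul', coeff_mul_C, coeff_C_mul] at h1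
  convert h1 using 3
  · split_ifs <;> simp
  · split_ifs <;> simp
  · split_ifs <;> simp
  · split_ifs <;> simp

theorem coeff_exchange {A : Type} [Ring A] [Algebra ℂ A] {F : PowerSeries (PowerSeries A)}
    {a b c : PowerSeries A}
    (h : scalarMap A (1 - X ^ 2 * C (X ^ 2)) * F * C a =
      (scalarMap A (1 - X ^ 2 * C (X ^ 2)) * C a - scalarMap A (2 * X) * C b +
        scalarMap A (X ^ 2) * C c) * F) (m : ℕ) :
    coeff m F * a - X ^ 2 * (if 2 ≤ m then coeff (m - 2) F else 0) * a =
      a * coeff m F - X ^ 2 * a * (if 2 ≤ m then coeff (m - 2) F else 0) -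
        2 * b * (if 1 ≤ m then coeff (m - 1) F else 0) +
        c * (if 2 ≤ m then coeff (m - 2) F else 0) := by
  refine coeff_exchange_aux ?_ m
  simpa only [map_sub, map_mul, map_one, map_pow, map_ofNat, scalarMap_X, scalarMap_C_X] using h

/-- The coefficient of `uⁿ` in `E⁺(u) Ē⁺(u)`. -/
def annihilationCoeff (n : ℤ) : PowerSeries (Module.End ℂ V) :=
  if n ≤ 0 then coeff (-n).toNat annihilationSeries else 0

theorem annihilationCoeff_add (m l : ℕ) : annihilationCoeff (-(m : ℤ) + l) =
    if l ≤ m then coeff (m - l) annihilationSeries else 0 := by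
  rw [annihilationCoeff]
  by_cases h : l ≤ m
  · rw [if_pos h, if_pos (by omega), show (-(-(m : ℤ) + l)).toNat = m - l by omega]
  · rw [if_neg h, if_neg (by omega)]

theorem annihilationCoeff_exchange (n j : ℤ) :
    annihilationCoeff n * creationCoeff j -
        X ^ 2 * annihilationCoeff (n + 2) * creationCoeff j =
      creationCoeff j * annihilationCoeff n -
        X ^ 2 * creationCoeff j * annihilationCoeff (n + 2) -
        2 * creationCoeff (j - 1) * annihilationCoeff (n + 1) +
        creationCoeff (j - 2) * annihilationCoeff (n + 2) := by
  by_cases hj : 0 ≤ j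
  · by_cases hn : n ≤ 0
    · obtain ⟨j, rfl⟩ := Int.eq_ofNat_of_zero_le hj
      obtain ⟨m, hm⟩ := Int.eq_ofNat_of_zero_le (show 0 ≤ -n by omega)
      obtain rfl : n = -(m : ℤ) := by omega
      have h0 := annihilationCoeff_add m 0
      have h1 := annihilationCoeff_add m 1
      have h2 := annihilationCoeff_add m 2
      simp only [Nat.cast_zero, Nat.cast_one, Nat.cast_two, add_zero, Nat.sub_zero,
        Nat.zero_le, if_true] at h0 h1 h2
      rw [h0, h1, h2]
      have h := coeff_exchange (A := Module.End ℂ V) (annihilation_exchange j) m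
      exact h
    · have h0 : annihilationCoeff n = 0 := if_neg hn
      have h1 : annihilationCoeff (n + 1) = 0 := if_neg (by omega)
      have h2 : annihilationCoeff (n + 2) = 0 := if_neg (by omega)
      rw [h0, h1, h2]
      simp
  · have h0 : creationCoeff j = 0 := if_neg hj
    have h1 : creationCoeff (j - 1) = 0 := if_neg (by omega)
    have h2 : creationCoeff (j - 2) = 0 := if_neg (by omega)
    rw [h0, h1, h2]
    simp

/-- The operator series `E⁻(0)⁻¹ E⁻(u)`. -/
def creationOp : OpSeries := ofU EMinusNormalized

/-- The operator series `E⁺(u) Ē⁺(u)`. -/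
def annihilationOp : OpSeries := ofUInv annihilationSeries

theorem creationOp_eq (j : ℤ) : creationOp j = toEnd (creationCoeff j) := by
  rw [creationOp, ofU, creationCoeff]
  split_ifs
  · rfl
  · exact (map_zero toEndHom).symm

theorem annihilationOp_eq (n : ℤ) : annihilationOp n = toEnd (annihilationCoeff n) := by
  rw [annihilationOp, ofUInv, annihilationCoeff]
  split_ifs
  · rfl
  · exact (map_zero toEndHom).symm

/-- Multiplication by `h²`. -/
abbrev hSq : FockEnd := toEnd (X ^ 2)

/-- The coefficients of `(1 - h² / u²) Φ(u) M(v) = ((u - v)² - h²) u⁻² M(v) Φ(u)`, where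
`Φ = annihilationOp` and `M = creationOp`. -/
theorem annihilationOp_exchange (n j : ℤ) :
    annihilationOp n * creationOp j - hSq * annihilationOp (n + 2) * creationOp j =
      creationOp j * annihilationOp n - hSq * creationOp j * annihilationOp (n + 2) -
        2 * creationOp (j - 1) * annihilationOp (n + 1) +
        creationOp (j - 2) * annihilationOp (n + 2) := by
  have h := congrArg toEndHom (annihilationCoeff_exchange n j)
  simp only [map_add, map_sub, map_mul, map_ofNat] at h
  simp only [creationOp_eq, annihilationOp_eq, ← toEndHom_apply]
  exact h

theorem hSq_commute (S : PowerSeries (Module.End ℂ V)) : Commute hSq (toEnd S) :=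
  Commute.map ((commute_X_pow S 2).symm) toEndHom

/-! ### Commuting operators -/

theorem exists_coeff_creationCoeff (j : ℤ) (k : ℕ) :
    ∃ g, coeff k (creationCoeff j) = creationHom g := by
  by_cases hj : 0 ≤ j
  · obtain ⟨j, rfl⟩ := Int.eq_ofNat_of_zero_le hj
    exact ⟨_, by rw [creationCoeff_natCast, coeff_map]; rfl⟩
  · exact ⟨0, by rw [creationCoeff, if_neg hj, map_zero, map_zero]⟩

theorem creationOp_commute (j l : ℤ) : Commute (creationOp j) (creationOp l) := by
  rw [creationOp_eq, creationOp_eq]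
  refine toEnd_commute fun m n => ?_
  obtain ⟨g, hg⟩ := exists_coeff_creationCoeff j m
  obtain ⟨g', hg'⟩ := exists_coeff_creationCoeff l n
  rw [hg, hg']
  exact (Commute.all g g').map creationHom

theorem creationOp_commute_eAlpha (j : ℤ) : Commute (creationOp j) (toEnd (C eAlpha)) := by
  rw [creationOp_eq]
  refine toEnd_commute fun m n => ?_
  obtain ⟨g, hg⟩ := exists_coeff_creationCoeff j m
  rw [hg, coeff_C]
  split_ifs
  · exact onCreation_commute_eAlpha _
  · exact Commute.zero_right _

theorem creationOp_commute_mode (j : ℤ) (p : ℤ → ℤ) (t : ℤ → PowerSeries ℂ) (n : ℤ) :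
    Commute (creationOp j) (mode p t n) := by
  rw [creationOp_eq]
  refine toEnd_commute fun m k => ?_
  obtain ⟨g, hg⟩ := exists_coeff_creationCoeff j m
  rw [hg, coeff_mk]
  exact onCreation_commute_diagInt _ _

theorem pderiv_commute {σ : Type} (x y : σ) (f : MvPolynomial σ ℂ) :
    MvPolynomial.pderiv x (MvPolynomial.pderiv y f) =
      MvPolynomial.pderiv y (MvPolynomial.pderiv x f) := by
  classical
  have h : ⁅MvPolynomial.pderiv (R := ℂ) x, MvPolynomial.pderiv (R := ℂ) y⁆ = 0 := by
    refine MvPolynomial.derivation_ext fun z => ?_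
    rw [Derivation.commutator_apply, MvPolynomial.pderiv_X, MvPolynomial.pderiv_X]
    simp only [Pi.single_apply]
    split_ifs <;> simp
  have h2 := congrArg (fun D : Derivation ℂ (MvPolynomial σ ℂ) (MvPolynomial σ ℂ) => D f) h
  rw [Derivation.commutator_apply] at h2
  exact sub_eq_zero.1 h2

theorem a_commute (j l : Fin 2) (r s : ℕ) : Commute (a j r) (a l s) := by
  refine endV_ext fun κ f => ?_
  simp only [a, if_neg (show ¬ ((r : ℤ) < 0) by omega), if_neg (show ¬ ((s : ℤ) < 0) by omega),
    Module.End.mul_apply, onCreation_single, LinearMap.smul_apply, map_smul,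
    Derivation.coeFn_coe, pderiv_commute (j, _)]
  rw [smul_comm]

theorem exists_a_eq_onCreation (j : Fin 2) (r : ℤ) : ∃ φ, a j r = onCreation φ := by
  rw [a]
  split_ifs <;> exact ⟨_, rfl⟩

theorem commute_coeff_formalExp_add {A : Type} [Ring A] [Algebra ℂ A] {x : A}
    {F G : PowerSeries (PowerSeries A)} (hF0 : coeff 0 (coeff 0 F) = 0)
    (hG0 : coeff 0 (coeff 0 G) = 0) (hF : ∀ m k, Commute x (coeff k (coeff m F)))
    (hG : ∀ m k, Commute x (coeff k (coeff m G))) (m k : ℕ) :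
    Commute x (coeff k (coeff m (formalExp (F + G)))) := by
  refine commute_coeff_formalExp (coeff_zero_add hF0 hG0) (fun m k => ?_) m k
  rw [map_add, map_add]
  exact (hF m k).add_right (hG m k)

theorem commute_coeff_formalExp_sub {A : Type} [Ring A] [Algebra ℂ A] {x : A}
    {F G : PowerSeries (PowerSeries A)} (hF0 : coeff 0 (coeff 0 F) = 0)
    (hG0 : coeff 0 (coeff 0 G) = 0) (hF : ∀ m k, Commute x (coeff k (coeff m F)))
    (hG : ∀ m k, Commute x (coeff k (coeff m G))) (m k : ℕ) :
    Commute x (coeff k (coeff m (formalExp (F - G)))) := by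
  refine commute_coeff_formalExp (coeff_zero_sub hF0 hG0) (fun m k => ?_) m k
  rw [map_sub, map_sub]
  exact (hF m k).sub_right (hG m k)

theorem commute_coeff_mul {A : Type} [Ring A] {x : A} {F G : PowerSeries (PowerSeries A)}
    (hF : ∀ m k, Commute x (coeff k (coeff m F))) (hG : ∀ m k, Commute x (coeff k (coeff m G)))
    (m k : ℕ) : Commute x (coeff k (coeff m (F * G))) := by
  rw [coeff_mul, map_sum]
  refine Commute.sum_right _ _ _ fun p _ => ?_
  rw [coeff_mul]
  exact Commute.sum_right _ _ _ fun q _ => (hF _ _).mul_right (hG _ _)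

theorem commute_coeff_posSum {x : Module.End ℂ V}
    (hx : ∀ (j : Fin 2) (r : ℕ), Commute x (a j r)) (j : Fin 2) (c : ℂ) (m k : ℕ) :
    Commute x (coeff k (coeff m (posSum j c))) := by
  rw [posSum, coeff_mk, coeff_mk]
  split_ifs
  · exact (hx j _).smul_right _
  · exact Commute.zero_right _

theorem commute_coeff_EBarPlusSeries {x : Module.End ℂ V}
    (hx : ∀ (j : Fin 2) (r : ℕ), Commute x (a j r)) (m k : ℕ) :
    Commute x (coeff k (coeff m EBarPlusSeries)) := by
  have hpos : ∀ j c m k, Commute x (coeff k (coeff m (posSum j c))) := commute_coeff_posSum hx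
  have hP := coeff_zero_posSum
  have h := commute_coeff_formalExp_add (A := Module.End ℂ V) (hP 0 (-7 / 4)) (hP 1 (1 / 4))
    (hpos 0 (-7 / 4)) (hpos 1 (1 / 4))
  have h' := h m k
  exact h'

/-- An operator commuting with all `a_j(r)`, `r > 0`, commutes with the coefficients of
`E⁺(u) Ē⁺(u)`. -/
theorem commute_coeff_annihilationSeries {x : Module.End ℂ V}
    (hx : ∀ (j : Fin 2) (r : ℕ), Commute x (a j r)) (m k : ℕ) :
    Commute x (coeff k (coeff m annihilationSeries)) := by
  have hpos : ∀ j c m k, Commute x (coeff k (coeff m (posSum j c))) := commute_coeff_posSum hx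
  have hP := coeff_zero_posSum
  have h1 := commute_coeff_formalExp_sub (A := Module.End ℂ V) (hP 0 (1 / 4)) (hP 1 (1 / 4))
    (hpos 0 (1 / 4)) (hpos 1 (1 / 4))
  have h2 := commute_coeff_mul (A := Module.End ℂ V) h1 (commute_coeff_EBarPlusSeries hx) m k
  exact h2

theorem commute_coeff_annihilationCoeff {x : Module.End ℂ V}
    (hx : ∀ (j : Fin 2) (r : ℕ), Commute x (a j r)) (n : ℤ) (k : ℕ) :
    Commute x (coeff k (annihilationCoeff n)) := by
  rw [annihilationCoeff]
  split_ifs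
  · exact commute_coeff_annihilationSeries hx _ _
  · rw [map_zero]
    exact Commute.zero_right _

theorem annihilationOp_commute (m n : ℤ) : Commute (annihilationOp m) (annihilationOp n) := by
  rw [annihilationOp_eq, annihilationOp_eq]
  refine toEnd_commute fun k l => commute_coeff_annihilationCoeff (fun j r => ?_) n l
  exact (commute_coeff_annihilationCoeff (fun j' r' => a_commute j j' r r') m k).symm

theorem annihilationOp_commute_eAlpha (n : ℤ) :
    Commute (annihilationOp n) (toEnd (C eAlpha)) := by
  rw [annihilationOp_eq]
  refine toEnd_commute fun k l => ?_
  rw [coeff_C]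
  split_ifs
  · refine (commute_coeff_annihilationCoeff (fun j r => ?_) n k).symm
    obtain ⟨φ, hφ⟩ := exists_a_eq_onCreation j r
    rw [hφ]
    exact (onCreation_commute_eAlpha φ).symm
  · exact Commute.zero_right _

theorem diagInt_commute_a (ψ : ℤ → ℂ) (j : Fin 2) (r : ℤ) : Commute (diagInt ψ) (a j r) := by
  obtain ⟨φ, hφ⟩ := exists_a_eq_onCreation j r
  rw [hφ]
  exact (onCreation_commute_diagInt φ ψ).symm

theorem annihilationOp_commute_mode (m : ℤ) (p : ℤ → ℤ) (t : ℤ → PowerSeries ℂ) (n : ℤ) :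
    Commute (annihilationOp m) (mode p t n) := by
  rw [annihilationOp_eq]
  refine toEnd_commute fun k l => ?_
  rw [coeff_mk]
  exact (commute_coeff_annihilationCoeff (fun j r => diagInt_commute_a _ j r) m k).symm

/-! ### Factorization of the vertex operators -/

/-- The number `(α, κ α + λ_i) = 2 κ + i`. -/
def alphaPairing (i : Fin 2) (κ : ℤ) : ℤ := 2 * κ + (i : ℕ)

/-- The series `(1 - x²)^{(α, κ α + λ_i) / 2}`. -/
def zeroModeSeries (i : Fin 2) (κ : ℤ) : PowerSeries ℂ :=
  binSeries (alphaPairing i κ / 2) 1 * binSeries (alphaPairing i κ / 2) (-1)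

/-- The operator series `e^α u^{∂_α} (1 - h² / u²)^{∂_{α/2}}`. -/
def shiftOp (i : Fin 2) : OpSeries := fun n =>
  toEnd (C eAlpha) * mode (alphaPairing i) (zeroModeSeries i) n

/-- The operator series `shiftOp` divided by `u² - h²`. As `(α, α) = 2`, the division amounts to
replacing the weight index `κ` by `κ - 1` in the zero modes. -/
def reducedShiftOp (i : Fin 2) : OpSeries := fun n =>
  toEnd (C eAlpha) * mode (fun κ => alphaPairing i (κ - 1)) (fun κ => zeroModeSeries i (κ - 1)) n

theorem shiftOp_locFinite (i : Fin 2) : LocFinite (shiftOp i) :=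
  comp_locFinite _ (mode_locFinite _ _)

theorem reducedShiftOp_locFinite (i : Fin 2) : LocFinite (reducedShiftOp i) :=
  comp_locFinite _ (mode_locFinite _ _)

theorem form_smul_left (c : ℂ) (x y : Fin 2 → ℂ) : form (c • x) y = c * form x y := by
  simp [form]

theorem form_neg_left (x y : Fin 2 → ℂ) : form (-x) y = -form x y := by
  simp [form]

theorem form_alpha (i : Fin 2) (κ : ℤ) : form alpha (weight i κ) = alphaPairing i κ :=
  form_alpha_weight i κ

theorem EZero_eq (i : Fin 2) : EZero i = fun n => toEnd (C eAlpha) *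
    mode (alphaPairing i) (fun κ => binSeries (alphaPairing i κ) (1 / 4)) n := by
  funext n
  rw [EZero, zeroMode_eq_mode i _ _ _ (alphaPairing i) (form_alpha i)]
  simp only [form_alpha]

theorem halfPowers_eq (i : Fin 2) : halfPowers i =
    mode (alphaPairing i) (fun κ => binSeries (alphaPairing i κ / 2) 1) := by
  rw [halfPowers, zeroMode_eq_mode i _ _ _ (alphaPairing i) (form_alpha i)]
  simp only [form_smul_left, form_alpha, one_div, inv_mul_eq_div]

theorem invPower_eq (i : Fin 2) : invPower i =
    mode (-alphaPairing i) (fun κ => binSeries (-alphaPairing i κ) (1 / 4)) := by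
  rw [invPower, zeroMode_eq_mode i _ _ _ (-alphaPairing i) fun κ => by
    rw [form_neg_left, form_alpha, Pi.neg_apply, Int.cast_neg]]
  simp only [form_neg_left, form_alpha]

theorem EBarZero_eq (i : Fin 2) : EBarZero i =
    mode 0 (fun κ => binSeries (alphaPairing i κ / 2) (-1)) := by
  rw [EBarZero, zeroMode_eq_mode i _ _ _ 0 fun κ => by simp]
  simp only [form_smul_left, form_alpha, one_div, inv_mul_eq_div]

theorem mul_congr {B B' C C' : OpSeries} (hB : B = B') (h : C = C') (hC : LocFinite C)
    (hC' : LocFinite C') : mul B C hC = mul B' C' hC' := by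
  subst hB h
  rfl

theorem mul_left_comm' {C D E : OpSeries} (hC : LocFinite C) (hD : LocFinite D)
    (hE : LocFinite E) (h : ∀ m n, Commute (C m) (D n)) :
    mul C (mul D E hE) (hD.mul hE) = mul D (mul C E hE) (hC.mul hE) :=
  (mul_assoc' C hD hE).symm.trans
    ((mul_congr (mul_comm' hC hD h) rfl hE hE).trans (mul_assoc' D hC hE))

/-- All zero modes of `X̄(u)` together; the powers of `u + h/4` cancel. -/
theorem zeroModes_mul (i : Fin 2) :
    mul (EZero i) (mul (halfPowers i) (mul (invPower i) (EBarZero i)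
      (zeroMode_locFinite i _ _ _)) ((zeroMode_locFinite i _ _ _).mul (zeroMode_locFinite i _ _ _)))
      ((zeroMode_locFinite i _ _ _).mul
        ((zeroMode_locFinite i _ _ _).mul (zeroMode_locFinite i _ _ _))) = shiftOp i := by
  have h1 := (mul_congr (invPower_eq i) (EBarZero_eq i) (zeroMode_locFinite i _ _ _)
    (mode_locFinite _ _)).trans (mode_mul _ _ _ _)
  have h2 := (mul_congr (halfPowers_eq i) h1 ((zeroMode_locFinite i _ _ _).mul
    (zeroMode_locFinite i _ _ _)) (mode_locFinite _ _)).trans (mode_mul _ _ _ _)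
  have h3 := (mul_congr (EZero_eq i) h2 ((zeroMode_locFinite i _ _ _).mul
    ((zeroMode_locFinite i _ _ _).mul (zeroMode_locFinite i _ _ _))) (mode_locFinite _ _)).trans
    (mul_left_end _ _ _)
  refine h3.trans (funext fun n => ?_)
  rw [shiftOp, mode_mul]
  congr 2
  · simp
  · funext κ
    simp only [Pi.mul_apply, zeroModeSeries]
    have h := binSeries_add (alphaPairing i κ) (-alphaPairing i κ) (1 / 4)
    rw [add_neg_cancel, binSeries_zero] at h
    linear_combination (-(binSeries (alphaPairing i κ / 2) 1 *
      binSeries (alphaPairing i κ / 2) (-1))) * h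

theorem annihilationOp_eq_mul : annihilationOp = mul EPlus EBarPlus EBarPlus_locFinite :=
  (ofUInv_mul _ _ EBarPlus_locFinite).symm

theorem annihilationOp_locFinite : LocFinite annihilationOp := by
  rw [annihilationOp_eq_mul]
  exact EPlus_locFinite.mul EBarPlus_locFinite

theorem EBarPlus_commute {x : PowerSeries (Module.End ℂ V)}
    (hx : ∀ k (j : Fin 2) (r : ℕ), Commute (coeff k x) (a j r)) (m : ℤ) :
    Commute (toEnd x) (EBarPlus m) := by
  rw [EBarPlus, ofUInv]
  split_ifs
  · exact toEnd_commute fun k l => commute_coeff_EBarPlusSeries (hx k) _ _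
  · exact Commute.zero_right _

theorem mode_commute_EBarPlus (p : ℤ → ℤ) (t : ℤ → PowerSeries ℂ) (n m : ℤ) :
    Commute (mode p t n) (EBarPlus m) :=
  EBarPlus_commute (fun k j r => by rw [coeff_mk]; exact diagInt_commute_a _ j r) m

theorem eAlpha_commute_EBarPlus (m : ℤ) : Commute (toEnd (C eAlpha)) (EBarPlus m) := by
  refine EBarPlus_commute (fun k j r => ?_) m
  rw [coeff_C]
  split_ifs
  · obtain ⟨φ, hφ⟩ := exists_a_eq_onCreation j r
    rw [hφ]
    exact (onCreation_commute_eAlpha φ).symm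
  · exact Commute.zero_left _

/-- The part `E⁺(u) Ē⁺(u) e^α u^{∂_α} (1 - h² / u²)^{∂_{α/2}}` of `X̄(u)` to the right of the
creation operators. -/
def rightOp (i : Fin 2) : OpSeries := mul annihilationOp (shiftOp i) (shiftOp_locFinite i)

/-- The operator series `rightOp` divided by `u² - h²`. -/
def reducedRightOp (i : Fin 2) : OpSeries :=
  mul annihilationOp (reducedShiftOp i) (reducedShiftOp_locFinite i)

theorem rightOp_locFinite (i : Fin 2) : LocFinite (rightOp i) :=
  annihilationOp_locFinite.mul (shiftOp_locFinite i)

theorem reducedRightOp_locFinite (i : Fin 2) : LocFinite (reducedRightOp i) :=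
  annihilationOp_locFinite.mul (reducedShiftOp_locFinite i)

/-- The normally ordered form of `X̄(u)`: `Ē⁺(u)` commutes with `e^α` and the zero modes, so it can
be moved next to `E⁺(u)`. -/
theorem XBar_eq_mul (i : Fin 2) :
    XBar i = mul creationOp (rightOp i) (rightOp_locFinite i) := by
  have hZ : ∀ m n, Commute (EZero i m) (EBarPlus n) := fun m n => by
    rw [EZero_eq]
    exact (eAlpha_commute_EBarPlus n).mul_left (mode_commute_EBarPlus _ _ m n)
  have hH : ∀ m n, Commute (halfPowers i m) (EBarPlus n) := fun m n => by
    rw [halfPowers_eq]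
    exact mode_commute_EBarPlus _ _ m n
  have hI : ∀ m n, Commute (invPower i m) (EBarPlus n) := fun m n => by
    rw [invPower_eq]
    exact mode_commute_EBarPlus _ _ m n
  have lZ := EZero_locFinite i
  have lH : LocFinite (halfPowers i) := zeroMode_locFinite i _ _ _
  have lI : LocFinite (invPower i) := zeroMode_locFinite i _ _ _
  have lO : LocFinite (EBarZero i) := zeroMode_locFinite i _ _ _
  have lQ := EBarPlus_locFinite
  have h1 := mul_left_comm' lI lQ lO hI
  have h2 := (mul_congr rfl h1 (lI.mul (lQ.mul lO)) (lQ.mul (lI.mul lO))).trans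
    (mul_left_comm' lH lQ (lI.mul lO) hH)
  have h3 := (mul_congr rfl h2 (lH.mul (lI.mul (lQ.mul lO))) (lQ.mul (lH.mul (lI.mul lO)))).trans
    (mul_left_comm' lZ lQ (lH.mul (lI.mul lO)) hZ)
  have h4 : XBar i = mul creationOp (mul EPlus (mul (EZero i) (mul (halfPowers i)
      (mul (invPower i) (mul EBarPlus (EBarZero i) lO) (lQ.mul lO)) (lI.mul (lQ.mul lO)))
      (lH.mul (lI.mul (lQ.mul lO)))) (lZ.mul (lH.mul (lI.mul (lQ.mul lO)))))
      (EPlus_locFinite.mul (lZ.mul (lH.mul (lI.mul (lQ.mul lO))))) := by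
    have h5 : XBar i = mul (mul (mul (mul (mul (mul creationOp EPlus EPlus_locFinite) (EZero i) lZ)
        (halfPowers i) lH) (invPower i) lI) EBarPlus lQ) (EBarZero i) lO := by
      rw [creationOp, ← EMinusZeroInv_mul_EMinus]
      rfl
    rw [h5, mul_assoc', mul_assoc', mul_assoc', mul_assoc', mul_assoc']
  rw [h4]
  refine mul_congr rfl ?_ _ _
  rw [rightOp]
  refine (mul_congr rfl (h3.trans (mul_congr rfl (zeroModes_mul i) (lZ.mul (lH.mul (lI.mul lO)))
    (shiftOp_locFinite i))) _ (lQ.mul (shiftOp_locFinite i))).trans ?_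
  rw [← mul_assoc']
  exact mul_congr annihilationOp_eq_mul.symm rfl _ _

/-! ### Exchange relations for the right parts -/

/-- The identity `shiftOp = (u² - h²) reducedShiftOp`. -/
theorem shiftOp_eq_sub (i : Fin 2) (n : ℤ) :
    shiftOp i n = reducedShiftOp i (n - 2) - hSq * reducedShiftOp i n := by
  have h := mode_shift (fun κ => alphaPairing i (κ - 1)) (fun κ => zeroModeSeries i (κ - 1)) n
  have h1 : (fun κ => alphaPairing i (κ - 1) + 2) = alphaPairing i := by
    funext κ
    simp only [alphaPairing]
    ring
  have h2 : (fun κ => zeroModeSeries i (κ - 1) * (1 - X ^ 2)) = zeroModeSeries i := by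
    funext κ
    have h3 : (alphaPairing i κ : ℂ) / 2 = alphaPairing i (κ - 1) / 2 + 1 := by
      simp only [alphaPairing]
      push_cast
      ring
    simp only [zeroModeSeries, h3, binSeries_add, binSeries_one, map_neg, map_one]
    ring
  rw [h1, h2] at h
  simp only [shiftOp, reducedShiftOp]
  rw [h, hSq, toEnd_X_pow]
  refine LinearMap.ext fun w => ?_
  simp only [Module.End.mul_apply, LinearMap.sub_apply, LinearMap.smul_apply, Module.End.one_apply,
    map_sub, map_smul]

theorem creationOp_commute_reducedShiftOp (i : Fin 2) (j n : ℤ) :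
    Commute (creationOp j) (reducedShiftOp i n) :=
  (creationOp_commute_eAlpha j).mul_right (creationOp_commute_mode j _ _ n)

theorem annihilationOp_commute_reducedShiftOp (i : Fin 2) (m n : ℤ) :
    Commute (annihilationOp m) (reducedShiftOp i n) :=
  (annihilationOp_commute_eAlpha m).mul_right (annihilationOp_commute_mode m _ _ n)

theorem hSq_commute_annihilationOp (n : ℤ) : Commute hSq (annihilationOp n) := by
  rw [annihilationOp_eq]
  exact hSq_commute _

/-- Moving `M` to the left past `S' - y S`, and `y` to the left past `P`. -/
theorem exchange_aux {A : Type} [Ring A] {P M S S' y : A} (h1 : Commute M S) (h2 : Commute M S')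
    (hP : Commute y P) : P * (S' - y * S) * M = P * M * S' - y * (P * M * S) := by
  rw [mul_sub, sub_mul, mul_assoc, ← h2.eq, mul_assoc P, mul_assoc y, ← h1.eq, ← mul_assoc,
    ← mul_assoc P, ← hP.eq]
  simp only [mul_assoc]

/-- The coefficients of `R(u) M(v) = ((u - v)² - h²) M(v) S(u)`, where `M`, `R`, `S` are
`creationOp`, `rightOp` and `reducedRightOp`. -/
theorem rightOp_mul_creationOp (i : Fin 2) (m j : ℤ) :
    rightOp i m * creationOp j =
      creationOp j * reducedRightOp i (m - 2) - hSq * creationOp j * reducedRightOp i m -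
        2 * creationOp (j - 1) * reducedRightOp i (m - 1) +
        creationOp (j - 2) * reducedRightOp i m := by
  refine LinearMap.ext fun w => ?_
  have hS := fun N => mul_hasHSum annihilationOp (reducedShiftOp_locFinite i) N w
  -- the sum over `annihilationOp * creationOp * reducedShiftOp`, before the exchange
  let B : OpSeries := fun n => annihilationOp n * creationOp j
  have hB := fun N => mul_hasHSum B (reducedShiftOp_locFinite i) N w
  have h1 : HasHSum (fun n => annihilationOp (m - n) (shiftOp i n (creationOp j w)))
      (mul B (reducedShiftOp i) (reducedShiftOp_locFinite i) (m - 2) w -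
        hSq (mul B (reducedShiftOp i) (reducedShiftOp_locFinite i) m w)) := by
    convert ((hB (m - 2)).equiv (Equiv.subRight 2)).sub ((hB m).map hSq) using 2 with n
    have h2 : annihilationOp (m - n) * shiftOp i n * creationOp j =
        B (m - n) * reducedShiftOp i (n - 2) - hSq * (B (m - n) * reducedShiftOp i n) := by
      rw [shiftOp_eq_sub]
      have h := exchange_aux (A := FockEnd) (creationOp_commute_reducedShiftOp i j n)
        (creationOp_commute_reducedShiftOp i j (n - 2)) (hSq_commute_annihilationOp (m - n))
      exact h
    have h3 := LinearMap.congr_fun h2 w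
    simp only [Equiv.subRight_apply, show m - 2 - (n - 2) = m - n by ring]
    exact h3
  have h4 : HasHSum (fun n => B (m - 2 - n) (reducedShiftOp i n w) -
      hSq (B (m - n) (reducedShiftOp i n w)))
      (creationOp j (reducedRightOp i (m - 2) w) - hSq (creationOp j (reducedRightOp i m w)) -
        (creationOp (j - 1) (reducedRightOp i (m - 1) w) +
          creationOp (j - 1) (reducedRightOp i (m - 1) w)) +
        creationOp (j - 2) (reducedRightOp i m w)) := by
    have h5 := (((((hS (m - 2)).map (creationOp j)).sub
      (((hS m).map (creationOp j)).map hSq)).sub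
      (((hS (m - 1)).map (creationOp (j - 1))).add ((hS (m - 1)).map (creationOp (j - 1))))).add
      ((hS m).map (creationOp (j - 2))))
    refine HasHSum.congr (fun n => ?_) h5
    have h6 := LinearMap.congr_fun (annihilationOp_exchange (m - 2 - n) j)
      (reducedShiftOp i n w)
    rw [show m - 2 - n + 2 = m - n by ring, show m - 2 - n + 1 = m - 1 - n by ring, two_mul] at h6
    simp only [LinearMap.sub_apply, LinearMap.add_apply, Module.End.mul_apply, add_mul] at h6
    exact h6
  have h7 := (((hB (m - 2)).sub ((hB m).map hSq)).unique h4)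
  have h8 := (mul_hasHSum annihilationOp (shiftOp_locFinite i) m (creationOp j w)).unique h1
  rw [two_mul]
  simp only [LinearMap.sub_apply, LinearMap.add_apply, Module.End.mul_apply, add_mul]
  exact h8.trans h7

/-- Moving `e^α` to the left past the zero modes of `reducedShiftOp` undoes the shift of the weight,
so that the zero modes of both factors agree. -/
theorem reducedShiftOp_mul_shiftOp (i : Fin 2) (m n : ℤ) :
    reducedShiftOp i m * shiftOp i n = reducedShiftOp i n * shiftOp i m := by
  have h : ∀ m, reducedShiftOp i m * toEnd (C eAlpha) =
      toEnd (C eAlpha) * (toEnd (C eAlpha) * mode (alphaPairing i) (zeroModeSeries i) m) :=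
    fun m => by
      rw [reducedShiftOp, mul_assoc, mode_mul_eAlpha]
      simp only [add_sub_cancel_right]
  simp only [shiftOp, ← mul_assoc, h]
  simp only [mul_assoc, (mode_commute _ _ _ _ m n).eq]

/-- The identity `S(u) R(v) = S(v) R(u)`, where `R`, `S` are `rightOp` and `reducedRightOp`. -/
theorem reducedRightOp_mul_rightOp (i : Fin 2) (a b : ℤ) :
    reducedRightOp i a * rightOp i b = reducedRightOp i b * rightOp i a := by
  refine LinearMap.ext fun w => ?_
  have h1 := mul_apply_mul_hasHSum annihilationOp annihilationOp (reducedShiftOp_locFinite i)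
    (shiftOp_locFinite i) a b w
  have h2 := mul_apply_mul_hasHSum annihilationOp annihilationOp (reducedShiftOp_locFinite i)
    (shiftOp_locFinite i) b a w
  refine h1.unique ?_
  refine HasHSum.congr (fun p => ?_)
    (h2.equiv (Equiv.prodComm ℤ ℤ))
  obtain ⟨m, n⟩ := p
  have h : annihilationOp (a - m) * (reducedShiftOp i m * (annihilationOp (b - n) * shiftOp i n)) =
      annihilationOp (b - n) * (reducedShiftOp i n * (annihilationOp (a - m) * shiftOp i m)) := by
    rw [← mul_assoc (reducedShiftOp i m), ← (annihilationOp_commute_reducedShiftOp i _ _).eq,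
      ← mul_assoc (reducedShiftOp i n), ← (annihilationOp_commute_reducedShiftOp i _ _).eq,
      mul_assoc, reducedShiftOp_mul_shiftOp, ← mul_assoc, ← mul_assoc, ← mul_assoc, ← mul_assoc,
      (annihilationOp_commute (a - m) (b - n)).eq]
  exact LinearMap.congr_fun h w

/-! ### Normally ordered products -/

/-- The summands of the coefficient of `uᵐ vⁿ` in `M(u) M(v) S(u) R(v) w`, where `M`, `R`, `S` are
`creationOp`, `rightOp` and `reducedRightOp`. -/
def normalTerm (i : Fin 2) (w : Fock) (m n : ℤ) (p : ℤ × ℤ) : Fock :=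
  creationOp (m - p.1) (creationOp (n - p.2) (reducedRightOp i p.1 (rightOp i p.2 w)))

/-- The coefficient of `uᵐ vⁿ` in `M(u) M(v) S(u) R(v) w`, where `M`, `R`, `S` are `creationOp`,
`rightOp` and `reducedRightOp`. -/
def normalProduct (i : Fin 2) (w : Fock) (m n : ℤ) : Fock :=
  PowerSeries.mk fun k => ∑ᶠ p, coeff k (normalTerm i w m n p)

theorem normalProduct_hasHSum (i : Fin 2) (w : Fock) (m n : ℤ) :
    HasHSum (normalTerm i w m n) (normalProduct i w m n) := fun k =>
  ⟨(reducedRightOp_locFinite i).pair_finite (rightOp_locFinite i w)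
    (fun a b => creationOp (m - a) * creationOp (n - b)) k, by rw [normalProduct, coeff_mk]⟩

theorem normalProduct_symm (i : Fin 2) (w : Fock) (m n : ℤ) :
    normalProduct i w m n = normalProduct i w n m := by
  refine (normalProduct_hasHSum i w m n).unique ?_
  refine HasHSum.congr (fun p => ?_)
    ((normalProduct_hasHSum i w n m).equiv (Equiv.prodComm ℤ ℤ))
  have h1 := LinearMap.congr_fun (creationOp_commute (m - p.1) (n - p.2)).eq
    (reducedRightOp i p.1 (rightOp i p.2 w))
  have h2 := LinearMap.congr_fun (reducedRightOp_mul_rightOp i p.1 p.2) w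
  simp only [Module.End.mul_apply] at h1 h2
  simp only [normalTerm, Equiv.prodComm_apply, Prod.fst_swap, Prod.snd_swap]
  rw [h1, h2]

/-- The coefficients of `X̄(u) X̄(v) w = ((u - v)² - h²) Z(u, v)`, where `Z` is the series
`normalProduct`. -/
theorem XBar_mul_XBar_apply (i : Fin 2) (w : Fock) (m n : ℤ) :
    XBar i m (XBar i n w) =
      normalProduct i w (m - 2) n - hSq (normalProduct i w m n) -
        (normalProduct i w (m - 1) (n - 1) + normalProduct i w (m - 1) (n - 1)) +
        normalProduct i w m (n - 2) := by
  rw [XBar_eq_mul]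
  refine (mul_apply_mul_hasHSum creationOp creationOp (rightOp_locFinite i)
    (rightOp_locFinite i) m n w).unique ?_
  have hz := normalProduct_hasHSum i w
  have h1 := (hz (m - 2) n).equiv ((Equiv.subRight 2).prodCongr (Equiv.refl ℤ))
  have h2 := (hz (m - 1) (n - 1)).equiv ((Equiv.subRight 1).prodCongr (Equiv.refl ℤ))
  refine HasHSum.congr (fun p => ?_)
    (((h1.sub ((hz m n).map hSq)).sub (h2.add h2)).add (hz m (n - 2)))
  have h3 := LinearMap.congr_fun (rightOp_mul_creationOp i p.1 (n - p.2)) (rightOp i p.2 w)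
  have h4 := LinearMap.congr_fun (((hSq_commute (creationCoeff (m - p.1)))).eq)
    (creationOp (n - p.2) (reducedRightOp i p.1 (rightOp i p.2 w)))
  rw [← creationOp_eq] at h4
  rw [two_mul] at h3
  simp only [LinearMap.sub_apply, LinearMap.add_apply, Module.End.mul_apply, add_mul] at h3 h4
  simp only [normalTerm, Equiv.prodCongr_apply, Prod.map_fst, Prod.map_snd, Equiv.subRight_apply,
    Equiv.refl_apply, h3, h4, map_sub, map_add, show m - 2 - (p.1 - 2) = m - p.1 by ring,
    show m - 1 - (p.1 - 1) = m - p.1 by ring, show n - 1 - p.2 = n - p.2 - 1 by ring,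
    show n - 2 - p.2 = n - p.2 - 2 by ring]

theorem creationOp_of_neg {j : ℤ} (hj : j < 0) : creationOp j = 0 := by
  rw [creationOp, ofU, if_neg (by omega)]

/-- A single bound serves all coefficients up to `hᵏ`. -/
theorem LowerBounded.forall_le {y : ℤ → ℤ → Fock} (hy : LowerBounded y) (k : ℕ) :
    ∃ B : ℤ, ∀ m n, m < B ∨ n < B → ∀ l ≤ k, coeff l (y m n) = 0 := by
  choose B hB using hy
  obtain ⟨B', hB'⟩ := ((Set.finite_Iic k).image B).bddBelow
  exact ⟨B', fun m n hmn l hl => hB l m n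
    (hmn.imp (fun h => h.trans_le (hB' ⟨l, hl, rfl⟩)) fun h => h.trans_le (hB' ⟨l, hl, rfl⟩))⟩

theorem normalProduct_lowerBounded (i : Fin 2) (w : Fock) :
    LowerBounded (normalProduct i w) := fun k => by
  have hfin := HasHSum.finite_le (f := fun p : ℤ × ℤ => reducedRightOp i p.1 (rightOp i p.2 w))
    ((reducedRightOp_locFinite i).pair_finite (rightOp_locFinite i w) fun _ _ => 1) k
  obtain ⟨B₁, h₁⟩ := (hfin.image Prod.fst).bddBelow
  obtain ⟨B₂, h₂⟩ := (hfin.image Prod.snd).bddBelow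
  refine ⟨min B₁ B₂, fun m n hmn => ?_⟩
  rw [← (normalProduct_hasHSum i w m n k).2]
  refine finsum_eq_zero_of_forall_eq_zero fun p => ?_
  by_cases hp : ∃ q ≤ k, coeff q (reducedRightOp i p.1 (rightOp i p.2 w)) ≠ 0
  · have h3 := h₁ ⟨p, hp, rfl⟩
    have h4 := h₂ ⟨p, hp, rfl⟩
    rw [normalTerm]
    rcases hmn with hm | hn
    · rw [creationOp_of_neg (j := m - p.1) (by omega), LinearMap.zero_apply, map_zero]
    · rw [creationOp_of_neg (j := n - p.2) (by omega), LinearMap.zero_apply, map_zero, map_zero]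
  · push Not at hp
    refine coeff_end_eq_zero (creationOp (m - p.1) * creationOp (n - p.2)) hp

/-! ### The formal limit `v → u + c h` -/

theorem binomial_succ (s c : ℂ) (k : ℕ) :
    binomial (s + 1) c (k + 1) = binomial s c (k + 1) + c * binomial s c k := by
  rw [binomial, binomial, binomial, Ring.choose_succ_succ]
  ring

/-- The evaluation at `v = u + c h` is defined for lower bounded series: modulo `h^{K+1}`, only the
terms `uᵐ vⁿ` with `n ≥ B`, `m ≥ B` and `m + n ≤ N + K` contribute to the coefficient of `u^N`. -/
theorem LowerBounded.exists_hasShiftedValue {y : ℤ → ℤ → Fock} (hy : LowerBounded y) (c : ℂ) :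
    ∃ s, HasShiftedValue c y s := by
  refine ⟨fun N => PowerSeries.mk fun K => ∑ᶠ x : ℤ × ℕ, coeff K
    ((binomial (x.1 : ℂ) c x.2 • (PowerSeries.X : PowerSeries ℂ) ^ x.2) •
      y (N - x.1 + x.2) x.1), fun N K => ⟨?_, by rw [coeff_mk]⟩⟩
  obtain ⟨B, hB⟩ := hy.forall_le K
  refine ((Set.finite_Icc B (N + K - B)).prod (Set.finite_Iic K)).subset fun x hx => ?_
  have h1 : ∃ p ∈ Finset.HasAntidiagonal.antidiagonal K,
      coeff p.1 (binomial (x.1 : ℂ) c x.2 • (PowerSeries.X : PowerSeries ℂ) ^ x.2) •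
        coeff p.2 (y (N - x.1 + x.2) x.1) ≠ 0 := by
    by_contra! hcon
    refine hx ?_
    rw [coeff_series_smul]
    exact Finset.sum_eq_zero hcon
  obtain ⟨p, hp, hne⟩ := h1
  rw [Finset.HasAntidiagonal.mem_antidiagonal] at hp
  have h2 : p.1 = x.2 := by
    by_contra h
    exact hne (by rw [map_smul, coeff_X_pow, if_neg h, smul_zero, zero_smul])
  have h3 : ¬ (N - x.1 + x.2 < B ∨ x.1 < B) := fun h => hne (by
    rw [hB _ _ h _ (by omega), smul_zero])
  simp only [Set.mem_prod, Set.mem_Icc, Set.mem_Iic]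
  omega

theorem series_smul_sub (c : PowerSeries ℂ) (w w' : Fock) : c • (w - w') = c • w - c • w' := by
  simp only [series_smul_def, mul_sub]

theorem add_series_smul (c d : PowerSeries ℂ) (w : Fock) : (c + d) • w = c • w + d • w := by
  simp only [series_smul_def, map_add, add_mul]

theorem HasShiftedValue.sub {c : ℂ} {y y' : ℤ → ℤ → Fock} {s s' : ℤ → Fock}
    (h : HasShiftedValue c y s) (h' : HasShiftedValue c y' s') :
    HasShiftedValue c (fun m n => y m n - y' m n) (fun N => s N - s' N) := fun N => by
  simpa only [series_smul_sub] using (h N).sub (h' N)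

theorem HasShiftedValue.map {c : ℂ} {y : ℤ → ℤ → Fock} {s : ℤ → Fock}
    (h : HasShiftedValue c y s) (T : FockEnd) :
    HasShiftedValue c (fun m n => T (y m n)) (fun N => T (s N)) := fun N => by
  simpa only [map_smul] using (h N).map T

/-- Multiplication by `u`. -/
theorem HasShiftedValue.shift_left {c : ℂ} {y : ℤ → ℤ → Fock} {s : ℤ → Fock}
    (h : HasShiftedValue c y s) :
    HasShiftedValue c (fun m n => y (m - 1) n) (fun N => s (N - 1)) := fun N => by
  refine HasHSum.congr (fun x => ?_) (h (N - 1))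
  beta_reduce
  rw [show N - x.1 + (x.2 : ℤ) - 1 = N - 1 - x.1 + x.2 by ring]

theorem HasHSum.extend {ι κ : Type} {f : ι → Fock} {g : κ → Fock} {s : Fock} (hf : HasHSum f s)
    {e : ι → κ} (he : Function.Injective e) (hg : ∀ x, g (e x) = f x)
    (h0 : ∀ y ∉ Set.range e, g y = 0) : HasHSum g s := fun k => by
  have hsub : Function.support (fun y => coeff k (g y)) ⊆ Set.range e := fun y hy => by
    by_contra h
    exact hy (by simp only [h0 y h, map_zero])
  refine ⟨((hf k).1.image e).subset fun y hy => ?_, ?_⟩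
  · obtain ⟨x, rfl⟩ := hsub hy
    exact ⟨x, by rwa [Set.mem_ofPred_eq, hg] at hy, rfl⟩
  · rw [← (hf k).2, ← finsum_mem_univ, finsum_mem_inter_support_eq' _ Set.univ (Set.range e)
      fun y hy => ⟨fun _ => hsub hy, fun _ => trivial⟩, finsum_mem_range he]
    simp only [hg]

/-- Multiplication by `v`, which becomes multiplication by `u + c h`. -/
theorem HasShiftedValue.shift_right {c : ℂ} {y : ℤ → ℤ → Fock} {s : ℤ → Fock}
    (h : HasShiftedValue c y s) :
    HasShiftedValue c (fun m n => y m (n - 1))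
      (fun N => s (N - 1) + (c • (X : PowerSeries ℂ)) • s N) := fun N => by
  -- the terms that Pascal's rule adds, from `binomial n c (k - 1)`
  have h1 : HasHSum (fun x : ℤ × ℕ => if x.2 = 0 then 0 else (c • (X : PowerSeries ℂ)) •
      (binomial (x.1 : ℂ) c (x.2 - 1) • (PowerSeries.X : PowerSeries ℂ) ^ (x.2 - 1)) •
      y (N - x.1 + (x.2 - 1 : ℕ)) x.1) ((c • (X : PowerSeries ℂ)) • s N) := by
    refine ((h N).smul (c • (X : PowerSeries ℂ))).extend
      (e := fun x => (x.1, x.2 + 1)) ?_ (fun x => ?_) ?_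
    · rintro ⟨a, b⟩ ⟨a', b'⟩ hab
      simpa using hab
    · rw [if_neg (Nat.succ_ne_zero _)]
      rfl
    · rintro ⟨a, b⟩ hab
      refine if_pos ?_
      by_contra hb
      exact hab ⟨(a, b - 1), by simp only [Prod.mk.injEq, true_and]; omega⟩
  refine HasHSum.congr (fun x => ?_)
    (((h (N - 1)).add h1).equiv ((Equiv.subRight 1).prodCongr (Equiv.refl ℕ)))
  obtain ⟨n, k⟩ := x
  obtain ⟨n, rfl⟩ : ∃ n', n = n' + 1 := ⟨n - 1, by ring⟩
  simp only [Equiv.prodCongr_apply, Prod.map_apply, Equiv.subRight_apply, Equiv.refl_apply,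
    add_sub_cancel_right]
  rcases k with _ | k
  · simp [binomial, show N - (n + 1) = N - 1 - n by ring]
  · rw [if_neg (Nat.succ_ne_zero _), Nat.add_sub_cancel, series_smul_smul, Int.cast_add,
      Int.cast_one, binomial_succ]
    rw [show N - (n + 1) + ((k + 1 : ℕ) : ℤ) = N - n + k by push_cast; ring,
      show N - 1 - n + ((k + 1 : ℕ) : ℤ) = N - n + k by push_cast; ring, ← add_series_smul]
    congr 1
    rw [add_smul, smul_mul_smul_comm, pow_succ']

/-- `(v - u)² - h²` vanishes at `v = u + c h` if `c² = 1`. -/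
theorem LowerBounded.hasShiftedValue_zero {y : ℤ → ℤ → Fock} (hy : LowerBounded y) {c : ℂ}
    (hc : c ^ 2 = 1) :
    HasShiftedValue c (fun m n => y (m - 2) n - hSq (y m n) -
      (y (m - 1) (n - 1) + y (m - 1) (n - 1)) + y m (n - 2)) 0 := by
  obtain ⟨s, hs⟩ := hy.exists_hasShiftedValue c
  -- multiplication by `v - u` becomes multiplication by `c h`
  have hD : ∀ {y : ℤ → ℤ → Fock} {s : ℤ → Fock}, HasShiftedValue c y s →
      HasShiftedValue c (fun m n => y m (n - 1) - y (m - 1) n)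
        (fun N => (c • (X : PowerSeries ℂ)) • s N) := fun h => by
    simpa only [add_sub_cancel_left] using h.shift_right.sub h.shift_left
  have h := (hD (hD hs)).sub (hs.map hSq)
  intro N
  have h1 : (0 : ℤ → Fock) N = (c • (X : PowerSeries ℂ)) • (c • (X : PowerSeries ℂ)) • s N -
      hSq (s N) := by
    rw [hSq, toEnd_X_pow, LinearMap.smul_apply, Module.End.one_apply, series_smul_smul,
      smul_mul_smul_comm, ← pow_two, ← pow_two, hc, one_smul, sub_self, Pi.zero_apply]
  rw [h1]
  refine HasHSum.congr (fun x => ?_) (h N)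
  congr 1
  have h2 : ∀ a : ℤ, a - 1 - 1 = a - 2 := fun a => by ring
  simp only [h2]
  abel

end DYangian

end

theorem mainTheorem7 (i : Fin 2) :
    (∀ m n : ℤ, DYangian.XBar i m * DYangian.XBar i n = DYangian.XBar i n * DYangian.XBar i m) ∧
    ∀ w : DYangian.Fock,
      DYangian.LowerBounded (fun m n => DYangian.XBar i m (DYangian.XBar i n w)) ∧
      DYangian.HasShiftedValue (-1) (fun m n => DYangian.XBar i m (DYangian.XBar i n w)) 0 ∧
      DYangian.HasShiftedValue 1 (fun m n => DYangian.XBar i m (DYangian.XBar i n w)) 0 := by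
  refine ⟨fun m n => LinearMap.ext fun w => ?_, fun w => ⟨fun k => ?_, ?_, ?_⟩⟩
  · have h := DYangian.normalProduct_symm i w
    rw [Module.End.mul_apply, Module.End.mul_apply, DYangian.XBar_mul_XBar_apply,
      DYangian.XBar_mul_XBar_apply, h (m - 2) n, h m n, h (m - 1) (n - 1), h m (n - 2)]
    abel
  · obtain ⟨B, hB⟩ := (DYangian.normalProduct_lowerBounded i w).forall_le k
    refine ⟨B, fun m n hmn => ?_⟩
    beta_reduce
    rw [DYangian.XBar_mul_XBar_apply, map_add, map_sub, map_sub, map_add,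
      hB (m - 2) n (by omega) k le_rfl, hB (m - 1) (n - 1) (by omega) k le_rfl,
      hB m (n - 2) (by omega) k le_rfl, DYangian.coeff_end_eq_zero DYangian.hSq (hB m n hmn)]
    simp
  · simp only [DYangian.XBar_mul_XBar_apply]
    exact (DYangian.normalProduct_lowerBounded i w).hasShiftedValue_zero (by norm_num)
  · simp only [DYangian.XBar_mul_XBar_apply]
    exact (DYangian.normalProduct_lowerBounded i w).hasShiftedValue_zero (by norm_num)
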